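/- Let $d\ge 4$ be an even integer, let $\Omega_d=\begin{pmatrix}0&I_{d/2}\\-I_{d/2}&0\end{pmatrix}$, let $|\omega_d\rangle=\frac1{\sqrt d}\sum_{j=1}^d|jj\rangle$ and $F_d=\sum_{i,j=1}^d|ij\rangle\langle ji|$, and for $a,b\in\mathbb R$ put $$\rho_{a,b}=\frac{1-a-b}{d^2}\,I_d\otimes I_d+a\,|\omega_d\rangle\langle\omega_d|+\frac bd\,(I_d\otimes\Omega_d)F_d(I_d\otimes\Omega_d)^*\in M_d(\mathbb C)\otimes M_d(\mathbb C).$$ For $k\in\mathbb N$ let $\mathcal{SN}_k$ be the convex hull of all $|\xi\rangle\langle\xi|$ with $\xi\in\mathbb C^d\otimes\mathbb C^d$ a unit vector of Schmidt rank at most $k$; the Schmidt number ${\rm SN}(\rho)$ of a state $\rho$ is the smallest $k$ with $\rho\in\mathcal{SN}_k$. A state (a positive semidefinite matrix of trace one) is PPT if its partial transpose $({\rm id}\otimes\top)(\rho)$ is positive semidefinite. Let $\mathbb T=\{(a,b)\in\mathbb R^2:\rho_{a,b}\text{ is a PPT state}\}$ and $\mathbb S_k=\{(a,b)\in\mathbb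 R^2:\rho_{a,b}\in\mathcal{SN}_k\}$. 1. Suppose $(a,b)\in\mathbb T\setminus\mathbb S_{d/2-1}$. Then for all $m\ge 0$, all unit vectors $v_1,\dots,v_m\in\mathbb C^d$ and all real numbers $p_0>0$, $p_1,\dots,p_m\ge 0$ with $\sum_{j=0}^m p_j=1$, the matrix $$\rho_{AB}=p_0\,\rho_{a,b}+\sum_{j=1}^m p_j\,|v_j\rangle\langle v_j|\otimes|\Omega_d v_j\rangle\langle\Omega_d v_j|$$ is a PPT state with ${\rm SN}(\rho_{AB})=d/2$. 2. This yields PPT states of Schmidt number $d/2$ without symplectic symmetry: there are $(a,b)\in\mathbb T\setminus\mathbb S_{d/2-1}$ and $m$, $v_j$, $p_j$ as in 1 for which $\rho_{AB}$ is neither invariant under conjugation by $S\otimes\overline S$ for all $S\in Sp(d)$ nor invariant under conjugation by $S\otimes S$ for all $S\in Sp(d)$, where $Sp(d)=\{S\in U(d):S^{\top}\Omega_d S=\Omega_d\}$. -/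

import Mathlib

open scoped Kronecker ComplexOrder

noncomputable section

/-! ### Bipartite vectors, Schmidt rank, Schmidt number, PPT states -/

/-- The product vector `v ⊗ w` in `ℂ^{α × β} = ℂ^α ⊗ ℂ^β`. -/
def tensorVec {α β : Type*} (v : EuclideanSpace ℂ α) (w : EuclideanSpace ℂ β) :
    EuclideanSpace ℂ (α × β) :=
  WithLp.toLp 2 fun x => v x.1 * w x.2

/-- The rank-one operator `|ξ⟩⟨ξ|`. -/
def ketbra {α : Type*} (ξ : EuclideanSpace ℂ α) : Matrix α α ℂ :=
  Matrix.of fun x y => ξ x * star (ξ y)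

/-- `ξ` has Schmidt rank `r`: it has a Schmidt decomposition `ξ = ∑ i, c i • v i ⊗ w i` with exactly
`r` terms, where the coefficients are positive and nonincreasing and `v`, `w` are orthonormal. -/
def HasSchmidtRank {α β : Type*} [Fintype α] [Fintype β]
    (ξ : EuclideanSpace ℂ (α × β)) (r : ℕ) : Prop :=
  ∃ (c : Fin r → ℝ) (v : Fin r → EuclideanSpace ℂ α) (w : Fin r → EuclideanSpace ℂ β),
    (∀ i, 0 < c i) ∧ Antitone c ∧ Orthonormal ℂ v ∧ Orthonormal ℂ w ∧
      ξ = ∑ i, (c i : ℂ) • tensorVec (v i) (w i)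

/-- The convex hull of the projections `|ξ⟩⟨ξ|` onto unit vectors `ξ` of Schmidt rank at most `k`. -/
def schmidtSet (α β : Type*) [Fintype α] [Fintype β] (k : ℕ) :
    Set (Matrix (α × β) (α × β) ℂ) :=
  convexHull ℝ {ρ | ∃ ξ : EuclideanSpace ℂ (α × β),
    ‖ξ‖ = 1 ∧ (∃ r ≤ k, HasSchmidtRank ξ r) ∧ ρ = ketbra ξ}

/-- `ρ` has Schmidt number `k`: `k` is the smallest natural number with `ρ ∈ schmidtSet α β k`. -/
def HasSchmidtNumber {α β : Type*} [Fintype α] [Fintype β]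
    (ρ : Matrix (α × β) (α × β) ℂ) (k : ℕ) : Prop :=
  IsLeast {l : ℕ | ρ ∈ schmidtSet α β l} k

/-- The partial transpose `(id ⊗ ⊤) ρ` on the second tensor factor. -/
def partialTranspose {α β : Type*} (ρ : Matrix (α × β) (α × β) ℂ) :
    Matrix (α × β) (α × β) ℂ :=
  Matrix.of fun x y => ρ (x.1, y.2) (y.1, x.2)

/-- A quantum state: a positive semidefinite matrix of unit trace. -/
def IsQuantumState {α : Type*} [Fintype α] (ρ : Matrix α α ℂ) : Prop :=
  ρ.PosSemidef ∧ ρ.trace = 1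

/-- A quantum state with positive semidefinite partial transpose. -/
def IsPPTState {α β : Type*} [Fintype α] [Fintype β]
    (ρ : Matrix (α × β) (α × β) ℂ) : Prop :=
  IsQuantumState ρ ∧ (partialTranspose ρ).PosSemidef

/-! ### The symplectic form and the states `ρ_{a,b}` -/

/-- The block matrix `[[0, I], [-I, 0]]` with blocks of size `d / 2` (used for even `d`). -/
def sympOmega (d : ℕ) : Matrix (Fin d) (Fin d) ℂ :=
  Matrix.of fun i j =>
    if (j : ℕ) = (i : ℕ) + d / 2 then 1 else if (i : ℕ) = (j : ℕ) + d / 2 then -1 else 0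

/-- The vector `Ω_d v`. -/
def omegaVec {d : ℕ} (v : EuclideanSpace ℂ (Fin d)) : EuclideanSpace ℂ (Fin d) :=
  WithLp.toLp 2 ((sympOmega d).mulVec v.ofLp)

/-- The maximally entangled unit vector `d^{-1/2} ∑ j, |jj⟩`. -/
def maxEntangled (d : ℕ) : EuclideanSpace ℂ (Fin d × Fin d) :=
  ((1 / Real.sqrt d : ℝ) : ℂ) •
    ∑ j : Fin d, tensorVec (EuclideanSpace.single j (1 : ℂ)) (EuclideanSpace.single j (1 : ℂ))

/-- The flip operator `∑ i j, |ij⟩⟨ji|`. -/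
def flipOp (d : ℕ) : Matrix (Fin d × Fin d) (Fin d × Fin d) ℂ :=
  Matrix.of fun x y => if x.1 = y.2 ∧ x.2 = y.1 then 1 else 0

/-- `ρ_{a,b} = (1-a-b)/d² I ⊗ I + a |ω⟩⟨ω| + (b/d) (I ⊗ Ω) F (I ⊗ Ω)^*`. -/
def sympRho (d : ℕ) (a b : ℝ) : Matrix (Fin d × Fin d) (Fin d × Fin d) ℂ :=
  (((1 - a - b) / (d : ℝ) ^ 2 : ℝ) : ℂ) • (1 : Matrix (Fin d × Fin d) (Fin d × Fin d) ℂ)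
    + (a : ℂ) • ketbra (maxEntangled d)
    + ((b / (d : ℝ) : ℝ) : ℂ) •
      (((1 : Matrix (Fin d) (Fin d) ℂ) ⊗ₖ sympOmega d) * flipOp d *
        ((1 : Matrix (Fin d) (Fin d) ℂ) ⊗ₖ sympOmega d).conjTranspose)

/-- The parameters `(a, b)` for which `ρ_{a,b}` is a PPT state. -/
def pptRegion (d : ℕ) : Set (ℝ × ℝ) :=
  {x | IsPPTState (sympRho d x.1 x.2)}

/-- The parameters `(a, b)` for which `ρ_{a,b}` is a state of Schmidt number at most `k`. -/
def schmidtRegion (d k : ℕ) : Set (ℝ × ℝ) :=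
  {x | sympRho d x.1 x.2 ∈ schmidtSet (Fin d) (Fin d) k}

/-- The mixture `p₀ ρ_{a,b} + ∑ j, p j |v j⟩⟨v j| ⊗ |Ω v j⟩⟨Ω v j|`. -/
def sympMixture (d : ℕ) (a b : ℝ) {m : ℕ} (p₀ : ℝ) (p : Fin m → ℝ)
    (v : Fin m → EuclideanSpace ℂ (Fin d)) : Matrix (Fin d × Fin d) (Fin d × Fin d) ℂ :=
  (p₀ : ℂ) • sympRho d a b
    + ∑ j, (p j : ℂ) • (ketbra (v j) ⊗ₖ ketbra (omegaVec (v j)))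

/-! ### Symplectic symmetry -/

/-- The compact symplectic group `Sp(d) = {S ∈ U(d) | Sᵀ Ω S = Ω}`. -/
def compactSymp (d : ℕ) : Set (Matrix (Fin d) (Fin d) ℂ) :=
  {S | S ∈ Matrix.unitaryGroup (Fin d) ℂ ∧ S.transpose * sympOmega d * S = sympOmega d}

/-- `ρ` is invariant under conjugation by `S ⊗ S` for all `S ∈ Sp(d)`. -/
def IsSSInvariant {d : ℕ} (ρ : Matrix (Fin d × Fin d) (Fin d × Fin d) ℂ) : Prop :=
  ∀ S ∈ compactSymp d, (S ⊗ₖ S) * ρ * (S ⊗ₖ S).conjTranspose = ρ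

/-- `ρ` is invariant under conjugation by `S ⊗ conj S` for all `S ∈ Sp(d)`. -/
def IsSSbarInvariant {d : ℕ} (ρ : Matrix (Fin d × Fin d) (Fin d × Fin d) ℂ) : Prop :=
  ∀ S ∈ compactSymp d, (S ⊗ₖ S.map star) * ρ * (S ⊗ₖ S.map star).conjTranspose = ρ

end

/-! ### Singular value decomposition and Schmidt rank -/

/-! Write n = d/2 and express the states as α·1 + β·J + γ·X, where J = Σ|aa⟩⟨cc| and X is the
twisted flip, a Hermitian involution with Xω = -ω. Four test vectors, two for the operator and two
for its partial transpose, give four linear inequalities on (α, β, γ). They cut out a cone with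
extreme rays 1 + J, 1 + X, (d-1)·1 - J - X and 1 + J + X. The first three are sums of product
projections; the last is an average of projections of Schmidt rank at most n
(`one_add_opJ_add_opX_mem`). So every PPT ρ_{a,b} has Schmidt number at most n, and mixing with
product states preserves both this and the PPT property.

For the lower bound, take the witness W = k(1 - X) - J. If ξ has Schmidt rank at most k, then ξ - Xξ
has Schmidt rank at most 2k, and its coefficient matrix has twice the trace of that of ξ; the bound
|tr C|² ≤ rank(C)·‖C‖² then says ⟨ξ, Wξ⟩ ≥ 0 (`witness_ketbra_nonneg`). Moreover W has expectation
zero at v ⊗ Ωv, because X fixes this vector and it is orthogonal to ω (`witness_tensor_omega`).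
Hence the witness at the mixture is p₀ times the witness at ρ_{a,b}.

The crux is that for k = n - 1 the witness is exact on the PPT region: if it is nonnegative at
ρ_{a,b}, then ρ_{a,b} has Schmidt number at most n - 1 (`invariantOp_mem_of_witness`). For n ≥ 3
this rests on an explicit operator on the zero line of the witness, decomposed into vectors of
Schmidt rank at most n - 1 (`exposed_mem`); for n = 2 separable operators suffice. A mixture of
Schmidt number below n would therefore put ρ_{a,b} in the excluded set.

For the second claim, the vertex 1 + J + X has negative witness, and Ω itself is a real element of
Sp(d) that moves the added product state. -/

open Module in
/-- Singular value decomposition of a linear map between finite-dimensional inner product spaces. -/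
theorem LinearMap.exists_singular_value_decomposition {E F : Type*}
    [NormedAddCommGroup E] [InnerProductSpace ℂ E] [FiniteDimensional ℂ E]
    [NormedAddCommGroup F] [InnerProductSpace ℂ F] [FiniteDimensional ℂ F] (T : E →ₗ[ℂ] F) :
    ∃ (v : Fin (finrank ℂ T.range) → F) (w : Fin (finrank ℂ T.range) → E),
      Orthonormal ℂ v ∧ Orthonormal ℂ w ∧
        ∀ x, T x = ∑ i : Fin (finrank ℂ T.range), ((T.singularValues i : ℝ) : ℂ) • (inner ℂ (w i) x) • v i := by
  classical
  set r := finrank ℂ T.range with hr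
  have hrn : r ≤ finrank ℂ E := LinearMap.finrank_range_le T
  let hs := T.isSymmetric_adjoint_comp_self
  let b := hs.eigenvectorBasis rfl
  -- The eigenvectors of T*T have orthogonal images of norm σ, so the normalised images are the left
  -- singular vectors.
  have hin : ∀ i j, inner ℂ (T (b i)) (T (b j))
      = ((T.singularValues j : ℝ) : ℂ) ^ 2 * inner ℂ (b i) (b j) := by
    intro i j
    rw [← LinearMap.adjoint_inner_right]
    have := hs.apply_eigenvectorBasis rfl j
    rw [← T.sq_singularValues_fin rfl j] at this
    simp only [LinearMap.comp_apply] at this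
    change inner ℂ (b i) (T.adjoint (T (b j))) = _
    rw [this, inner_smul_right]
    simp [b]
  have hpos : ∀ i : Fin r, 0 < T.singularValues i := fun i =>
    T.singularValues_pos_iff_lt_finrank_range.2 i.2
  have hbo := b.orthonormal
  rw [orthonormal_iff_ite] at hbo
  have hw : Orthonormal ℂ fun i : Fin r => b (Fin.castLE hrn i) :=
    b.orthonormal.comp _ (Fin.castLE_injective hrn)
  refine ⟨fun i => ((T.singularValues i : ℝ) : ℂ)⁻¹ • T (b (Fin.castLE hrn i)),
    fun i => b (Fin.castLE hrn i), ?_, hw, ?_⟩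
  · rw [orthonormal_iff_ite]
    intro i j
    rw [inner_smul_left, inner_smul_right, hin, hbo]
    have h1 : ((T.singularValues j : ℝ) : ℂ) ≠ 0 := by exact_mod_cast (hpos j).ne'
    by_cases hij : i = j
    · subst hij
      simp only [if_true, Fin.val_castLE, map_inv₀, Complex.conj_ofReal]
      field_simp
    · rw [if_neg hij, if_neg (fun h => hij (Fin.castLE_injective hrn h))]
      simp
  · intro x
    have hx : T x = ∑ i, (inner ℂ (b i) x) • T (b i) := by
      conv_lhs => rw [← b.sum_repr' x]
      simp
    have hzero : ∀ i : Fin (finrank ℂ E), r ≤ i → T (b i) = 0 := by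
      intro i hi
      have := hin i i
      rw [T.singularValues_eq_zero_iff_le_finrank_range.2 hi] at this
      simpa using this
    rw [hx]
    symm
    have hinj := Fin.castLE_injective hrn
    rw [← Finset.sum_subset (Finset.subset_univ (Finset.univ.map ⟨_, hinj⟩))]
    · rw [Finset.sum_map]
      refine Finset.sum_congr rfl fun i _ => ?_
      have h1 : ((T.singularValues i : ℝ) : ℂ) ≠ 0 := by exact_mod_cast (hpos i).ne'
      simp only [Function.Embedding.coeFn_mk]
      rw [smul_comm, smul_smul _ _ (T _), mul_inv_cancel₀ h1, one_smul]
    · intro i _ hi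
      rw [hzero i, smul_zero]
      by_contra h
      exact hi (Finset.mem_map.2 ⟨⟨i, by omega⟩, Finset.mem_univ _, Fin.ext rfl⟩)

section Schmidt

variable {α β : Type*} [Fintype α] [Fintype β]

@[simp] theorem tensorVec_apply {α β : Type*} (v : EuclideanSpace ℂ α) (w : EuclideanSpace ℂ β)
    (x : α × β) : tensorVec v w x = v x.1 * w x.2 := rfl

@[simp] theorem ketbra_apply {α : Type*} (ξ : EuclideanSpace ℂ α) (x y : α) :
    ketbra ξ x y = ξ x * star (ξ y) := rfl

/-- The entrywise complex conjugate of a vector. -/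
noncomputable def conjVec {α : Type*} (v : EuclideanSpace ℂ α) : EuclideanSpace ℂ α :=
  WithLp.toLp 2 fun x => star (v x)

@[simp] theorem conjVec_apply {α : Type*} (v : EuclideanSpace ℂ α) (x : α) :
    conjVec v x = star (v x) := rfl

theorem Orthonormal.conjVec {ι : Type*} {v : ι → EuclideanSpace ℂ α} (hv : Orthonormal ℂ v) :
    Orthonormal ℂ fun i => conjVec (v i) := by
  classical
  rw [orthonormal_iff_ite] at hv ⊢
  intro i j
  have := hv j i
  simp only [PiLp.inner_apply, RCLike.inner_apply] at this ⊢
  simp only [eq_comm (a := i), ← this]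
  refine Finset.sum_congr rfl fun x _ => ?_
  simp [mul_comm]

/-- A sum of at most `k` product vectors has Schmidt rank at most `k`. -/
theorem exists_hasSchmidtRank_of_sum {κ : Type*} (s : Finset κ) {k : ℕ} (hk : s.card ≤ k)
    (v : κ → EuclideanSpace ℂ α) (w : κ → EuclideanSpace ℂ β) :
    ∃ r ≤ k, HasSchmidtRank (∑ i ∈ s, tensorVec (v i) (w i)) r := by
  classical
  set ξ := ∑ i ∈ s, tensorVec (v i) (w i) with hξ
  -- The coefficient matrix of ξ, without conjugation: its range lies in the span of the `v i`. The
  -- right singular vectors enter the Schmidt decomposition conjugated.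
  let T : EuclideanSpace ℂ β →ₗ[ℂ] EuclideanSpace ℂ α :=
    Matrix.toEuclideanLin (Matrix.of fun a b => ξ (a, b))
  have hT : ∀ x, T x = ∑ i ∈ s, (∑ b, w i b * x b) • v i := by
    intro x
    ext a
    simp only [T, Matrix.toLpLin_apply, Matrix.mulVec, dotProduct, Matrix.of_apply,
      WithLp.ofLp_sum, Finset.sum_apply, PiLp.smul_apply, smul_eq_mul, hξ, tensorVec_apply,
      Finset.sum_mul]
    rw [Finset.sum_comm]
    refine Finset.sum_congr rfl fun i _ => Finset.sum_congr rfl fun b _ => ?_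
    ring
  have hrank : Module.finrank ℂ T.range ≤ k := by
    refine le_trans ?_ (le_trans (Finset.card_image_le (s := s) (f := v)) hk)
    refine le_trans (Submodule.finrank_mono ?_) (finrank_span_finset_le_card (s.image v))
    rintro _ ⟨x, rfl⟩
    rw [hT]
    exact Submodule.sum_mem _ fun i hi => Submodule.smul_mem _ _
      (Submodule.subset_span (by simpa using ⟨i, hi, rfl⟩))
  obtain ⟨a, b, ha, hb, hab⟩ := T.exists_singular_value_decomposition
  refine ⟨_, hrank, fun i => T.singularValues i, a, fun i => conjVec (b i),
    fun i => T.singularValues_pos_iff_lt_finrank_range.2 i.2,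
    fun i j hij => T.singularValues_antitone hij, ha, hb.conjVec, ?_⟩
  ext ⟨x, y⟩
  have h1 : ξ (x, y) = T (EuclideanSpace.single y 1) x := by
    simp [T, Matrix.toLpLin_apply]
  rw [h1, hab]
  simp only [WithLp.ofLp_sum, Finset.sum_apply, PiLp.smul_apply, smul_eq_mul, tensorVec_apply,
    conjVec_apply]
  refine Finset.sum_congr rfl fun i _ => ?_
  rw [EuclideanSpace.inner_single_right]
  simp [mul_comm]

theorem norm_tensorVec (v : EuclideanSpace ℂ α) (w : EuclideanSpace ℂ β) :
    ‖tensorVec v w‖ = ‖v‖ * ‖w‖ := by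
  rw [EuclideanSpace.norm_eq, EuclideanSpace.norm_eq, EuclideanSpace.norm_eq,
    ← Real.sqrt_mul (by positivity), Finset.sum_mul_sum, Fintype.sum_prod_type]
  simp [mul_pow]

theorem inner_tensorVec (v v' : EuclideanSpace ℂ α) (w w' : EuclideanSpace ℂ β) :
    inner ℂ (tensorVec v w) (tensorVec v' w') = inner ℂ v v' * inner ℂ w w' := by
  simp only [PiLp.inner_apply, RCLike.inner_apply, tensorVec_apply, Finset.sum_mul_sum,
    Fintype.sum_prod_type]
  refine Finset.sum_congr rfl fun i _ => Finset.sum_congr rfl fun j _ => ?_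
  simp; ring

/-- The squared norm of a vector is the sum of its squared Schmidt coefficients. -/
theorem norm_sq_of_schmidt {r : ℕ} {c : Fin r → ℝ} {v : Fin r → EuclideanSpace ℂ α}
    {w : Fin r → EuclideanSpace ℂ β} (hv : Orthonormal ℂ v) (hw : Orthonormal ℂ w) :
    ‖∑ i, (c i : ℂ) • tensorVec (v i) (w i)‖ ^ 2 = ∑ i, c i ^ 2 := by
  classical
  have ho : Orthonormal ℂ fun i => tensorVec (v i) (w i) := by
    rw [orthonormal_iff_ite] at hv hw ⊢
    intro i j
    rw [inner_tensorVec, hv, hw]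
    split_ifs <;> simp
  have := ho.inner_sum (fun i => (c i : ℂ)) (fun i => (c i : ℂ)) Finset.univ
  rw [inner_self_eq_norm_sq_to_K] at this
  have h2 : ((‖∑ i, (c i : ℂ) • tensorVec (v i) (w i)‖ ^ 2 : ℝ) : ℂ) = ((∑ i, c i ^ 2 : ℝ) : ℂ) := by
    push_cast
    refine this.trans (Finset.sum_congr rfl fun i _ => ?_)
    simp [sq]
  exact_mod_cast h2

/-- The trace of the coefficient matrix of a vector of Schmidt rank `r`, squared, is at most
`r` times the squared norm. -/
theorem HasSchmidtRank.norm_sum_diag_sq_le {ξ : EuclideanSpace ℂ (α × α)} {r : ℕ}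
    (h : HasSchmidtRank ξ r) : ‖∑ a, ξ (a, a)‖ ^ 2 ≤ r * ‖ξ‖ ^ 2 := by
  obtain ⟨c, v, w, hc, -, hv, hw, rfl⟩ := h
  rw [norm_sq_of_schmidt hv hw]
  -- Each Schmidt term contributes `c i` times the inner product of two unit vectors to the trace.
  have h1 : ‖∑ a, (∑ i, (c i : ℂ) • tensorVec (v i) (w i)) (a, a)‖ ≤ ∑ i, c i := by
    have : ∑ a, (∑ i, (c i : ℂ) • tensorVec (v i) (w i)) (a, a)
        = ∑ i, (c i : ℂ) * inner ℂ (conjVec (v i)) (w i) := by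
      simp only [WithLp.ofLp_sum, Finset.sum_apply, PiLp.smul_apply, smul_eq_mul, tensorVec_apply]
      rw [Finset.sum_comm]
      refine Finset.sum_congr rfl fun i _ => ?_
      rw [← Finset.mul_sum]
      simp [PiLp.inner_apply, mul_comm]
    rw [this]
    refine (norm_sum_le _ _).trans (Finset.sum_le_sum fun i _ => ?_)
    rw [norm_mul, Complex.norm_real, Real.norm_of_nonneg (hc i).le]
    have h2 := norm_inner_le_norm (𝕜 := ℂ) (conjVec (v i)) (w i)
    rw [hv.conjVec.1 i, hw.1 i, mul_one] at h2
    exact mul_le_of_le_one_right (hc i).le h2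
  calc _ ≤ (∑ i, c i) ^ 2 := by gcongr
    _ ≤ r * ∑ i, c i ^ 2 := by simpa using sq_sum_le_card_mul_sum_sq (s := Finset.univ) (f := c)

end Schmidt

/-! ### The cone generated by vectors of bounded Schmidt rank -/

section Cone

variable {α β : Type*}

theorem ketbra_posSemidef [Fintype α] (ξ : EuclideanSpace ℂ α) : (ketbra ξ).PosSemidef :=
  Matrix.posSemidef_vecMulVec_self_star ξ.ofLp

theorem trace_ketbra [Fintype α] (ξ : EuclideanSpace ℂ α) :
    (ketbra ξ).trace = ((‖ξ‖ ^ 2 : ℝ) : ℂ) := by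
  rw [EuclideanSpace.norm_sq_eq]
  simp only [Matrix.trace, Matrix.diag, ketbra_apply]
  push_cast
  refine Finset.sum_congr rfl fun i _ => ?_
  rw [← Complex.mul_conj']
  rfl

theorem ketbra_smul (c : ℂ) (ξ : EuclideanSpace ℂ α) :
    ketbra (c • ξ) = ((‖c‖ ^ 2 : ℝ) : ℂ) • ketbra ξ := by
  ext x y
  simp only [ketbra_apply, PiLp.smul_apply, smul_eq_mul, Matrix.smul_apply, star_mul']
  push_cast
  rw [← Complex.mul_conj']
  simp; ring

theorem ketbra_kronecker (v : EuclideanSpace ℂ α) (w : EuclideanSpace ℂ β) :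
    ketbra v ⊗ₖ ketbra w = ketbra (tensorVec v w) := by
  ext x y
  simp; ring

variable [Fintype α] [Fintype β]

variable (α β) in
/-- The cone generated by the operators `|ξ⟩⟨ξ|` with `ξ` of Schmidt rank at most `k`. -/
noncomputable def schmidtCone (k : ℕ) : PointedCone ℝ (Matrix (α × β) (α × β) ℂ) :=
  PointedCone.hull ℝ {ρ | ∃ ξ, (∃ r ≤ k, HasSchmidtRank ξ r) ∧ ρ = ketbra ξ}

theorem ketbra_mem_schmidtCone {k : ℕ} {ξ : EuclideanSpace ℂ (α × β)}
    (h : ∃ r ≤ k, HasSchmidtRank ξ r) : ketbra ξ ∈ schmidtCone α β k :=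
  Submodule.subset_span ⟨ξ, h, rfl⟩

theorem ketbra_sum_mem_schmidtCone {κ : Type*} (s : Finset κ) {k : ℕ} (hk : s.card ≤ k)
    (v : κ → EuclideanSpace ℂ α) (w : κ → EuclideanSpace ℂ β) :
    ketbra (∑ i ∈ s, tensorVec (v i) (w i)) ∈ schmidtCone α β k :=
  ketbra_mem_schmidtCone (exists_hasSchmidtRank_of_sum s hk v w)

theorem ketbra_tensorVec_mem_schmidtCone {k : ℕ} (hk : 1 ≤ k) (v : EuclideanSpace ℂ α)
    (w : EuclideanSpace ℂ β) : ketbra (tensorVec v w) ∈ schmidtCone α β k := by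
  simpa using ketbra_sum_mem_schmidtCone (Finset.univ : Finset Unit) (by simpa using hk)
    (fun _ => v) (fun _ => w)

theorem schmidtSet_mono {k l : ℕ} (h : k ≤ l) : schmidtSet α β k ⊆ schmidtSet α β l :=
  convexHull_mono fun _ ⟨ξ, h1, ⟨r, hr, hξ⟩, e⟩ => ⟨ξ, h1, ⟨r, hr.trans h, hξ⟩, e⟩

theorem posSemidef_of_mem_schmidtCone {k : ℕ} {ρ : Matrix (α × β) (α × β) ℂ}
    (h : ρ ∈ schmidtCone α β k) : ρ.PosSemidef := by
  induction h using Submodule.span_induction with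
  | mem x hx => obtain ⟨ξ, -, rfl⟩ := hx; exact ketbra_posSemidef ξ
  | zero => exact Matrix.PosSemidef.zero
  | add x y _ _ hx hy => exact hx.add hy
  | smul c x _ hx => exact hx.smul c.2

theorem HasSchmidtRank.real_smul {ξ : EuclideanSpace ℂ (α × β)} {r : ℕ} (h : HasSchmidtRank ξ r)
    {t : ℝ} (ht : 0 < t) : HasSchmidtRank ((t : ℂ) • ξ) r := by
  obtain ⟨c, v, w, hc, ha, hv, hw, rfl⟩ := h
  refine ⟨fun i => t * c i, v, w, fun i => mul_pos ht (hc i), fun i j hij =>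
    mul_le_mul_of_nonneg_left (ha hij) ht.le, hv, hw, ?_⟩
  rw [Finset.smul_sum]
  simp [mul_smul]

/-- An element of the Schmidt cone is a nonnegative multiple of an element of the Schmidt set, and
the multiple is its trace. -/
theorem exists_trace_of_mem_schmidtCone {k : ℕ} {ρ : Matrix (α × β) (α × β) ℂ}
    (h : ρ ∈ schmidtCone α β k) :
    ∃ t : ℝ, 0 ≤ t ∧ ρ.trace = t ∧ (ρ = 0 ∨ 0 < t ∧ ∃ σ ∈ schmidtSet α β k, ρ = t • σ) := by
  induction h using Submodule.span_induction with
  | mem x hx =>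
    obtain ⟨ξ, ⟨r, hr, hξ⟩, rfl⟩ := hx
    refine ⟨‖ξ‖ ^ 2, by positivity, trace_ketbra ξ, ?_⟩
    by_cases h0 : ξ = 0
    · left; ext x y; simp [h0]
    · right
      have hn : 0 < ‖ξ‖ := norm_pos_iff.2 h0
      refine ⟨by positivity, ketbra (((‖ξ‖⁻¹ : ℝ) : ℂ) • ξ), subset_convexHull _ _
        ⟨_, ?_, ⟨r, hr, hξ.real_smul (inv_pos.2 hn)⟩, rfl⟩, ?_⟩
      · rw [norm_smul, Complex.norm_real, norm_inv, norm_norm, inv_mul_cancel₀ hn.ne']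
      · rw [ketbra_smul, Complex.norm_real, norm_inv, norm_norm, Complex.coe_smul, smul_smul]
        field_simp
        simp
  | zero => exact ⟨0, le_rfl, by simp, Or.inl rfl⟩
  | add x y _ _ hx hy =>
    obtain ⟨t, ht, htx, h1⟩ := hx
    obtain ⟨u, hu, huy, h2⟩ := hy
    refine ⟨t + u, by positivity, by rw [Matrix.trace_add, htx, huy]; push_cast; rfl, ?_⟩
    rcases h1 with rfl | ⟨ht', σ, hσ, rfl⟩
    · have : t = 0 := by simpa using htx.symm
      simpa [this] using h2
    · rcases h2 with rfl | ⟨hu', σ', hσ', rfl⟩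
      · have : u = 0 := by simpa using huy.symm
        right
        exact ⟨by positivity, σ, hσ, by simp [this]⟩
      · right
        refine ⟨by positivity, (t / (t + u)) • σ + (u / (t + u)) • σ',
          convex_convexHull ℝ _ hσ hσ' (by positivity) (by positivity) (by field_simp), ?_⟩
        rw [smul_add, smul_smul, smul_smul]
        congr 2 <;> field_simp
  | smul c x _ hx =>
    obtain ⟨t, ht, htx, h1⟩ := hx
    have hc := c.2
    refine ⟨(c : ℝ) * t, by positivity, ?_, ?_⟩
    · change ((c : ℝ) • x).trace = _
      rw [Matrix.trace_smul, htx]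
      push_cast
      exact Complex.real_smul
    · rcases h1 with rfl | ⟨ht', σ, hσ, rfl⟩
      · left; simp
      · rcases hc.eq_or_lt with h0 | h0
        · left
          change (c : ℝ) • t • σ = 0
          rw [← h0, zero_smul]
        · right
          exact ⟨by positivity, σ, hσ, smul_smul (c : ℝ) t σ⟩

/-- Trace one fixes the scale, so all decompositions can be carried out in the cone without
normalising the vectors. -/
theorem mem_schmidtSet_of_mem_schmidtCone {k : ℕ} {ρ : Matrix (α × β) (α × β) ℂ}
    (h : ρ ∈ schmidtCone α β k) (h1 : ρ.trace = 1) : ρ ∈ schmidtSet α β k := by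
  obtain ⟨t, -, ht, h⟩ := exists_trace_of_mem_schmidtCone h
  have ht1 : t = 1 := by
    rw [h1] at ht
    exact_mod_cast ht.symm
  rcases h with rfl | ⟨-, σ, hσ, rfl⟩
  · simp at h1
  · simpa [ht1] using hσ

end Cone

/-! ### The cone of separable operators -/

section ProductCone

variable {α β : Type*}

variable (α β) in
/-- The cone generated by product vectors. -/
noncomputable def productCone : PointedCone ℝ (Matrix (α × β) (α × β) ℂ) :=
  PointedCone.hull ℝ {ρ | ∃ v w, ρ = ketbra (tensorVec v w)}

theorem ketbra_mem_productCone (v : EuclideanSpace ℂ α) (w : EuclideanSpace ℂ β) :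
    ketbra (tensorVec v w) ∈ productCone α β :=
  Submodule.subset_span ⟨v, w, rfl⟩

theorem productCone_le_schmidtCone [Fintype α] [Fintype β] {k : ℕ} (hk : 1 ≤ k) : productCone α β ≤ schmidtCone α β k :=
  Submodule.span_le.2 fun _ ⟨v, w, e⟩ => e ▸ ketbra_tensorVec_mem_schmidtCone hk v w

/-- B*B is the sum of the projections onto the conjugated rows of B. -/
theorem ketbra_kronecker_mem_productCone [Fintype β] (v : EuclideanSpace ℂ α) (B : Matrix β β ℂ) :
    ketbra v ⊗ₖ (B.conjTranspose * B) ∈ productCone α β := by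
  have : ketbra v ⊗ₖ (B.conjTranspose * B)
      = ∑ k, ketbra (tensorVec v (WithLp.toLp 2 fun x => star (B k x))) := by
    ext x y
    simp [Matrix.mul_apply, Matrix.sum_apply, Finset.mul_sum]
    exact Finset.sum_congr rfl fun _ _ => by ring
  rw [this]
  exact Submodule.sum_mem _ fun k _ => ketbra_mem_productCone _ _

/-- A linear map preserves the cone of product vectors if it maps the generators into it. -/
theorem map_mem_productCone (L : Matrix (α × β) (α × β) ℂ →ₗ[ℝ] Matrix (α × β) (α × β) ℂ)
    (hL : ∀ v w, L (ketbra (tensorVec v w)) ∈ productCone α β) {ρ : Matrix (α × β) (α × β) ℂ}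
    (h : ρ ∈ productCone α β) : L ρ ∈ productCone α β := by
  induction h using Submodule.span_induction with
  | mem x hx => obtain ⟨v, w, rfl⟩ := hx; exact hL v w
  | zero => rw [map_zero]; exact Submodule.zero_mem _
  | add x y _ _ hx hy => rw [map_add]; exact Submodule.add_mem _ hx hy
  | smul c x _ hx =>
    have : L (c • x) = (c : ℝ) • L x := L.map_smul (c : ℝ) x
    rw [this]
    exact PointedCone.smul_mem _ c.2 hx

end ProductCone

/-! ### Averages over random signs and phases -/

section Averages

/-- Translation by g leaves the sum unchanged but multiplies it by c ≠ 1. All vanishing moments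
below come from this. -/
theorem sum_eq_zero_of_translate {G : Type*} [Group G] [Fintype G] {f : G → ℂ} (g : G) {c : ℂ}
    (hc : c ≠ 1) (h : ∀ x, f (g * x) = c * f x) : ∑ x, f x = 0 := by
  have h1 : ∑ x, f x = c * ∑ x, f x := by
    rw [Finset.mul_sum, ← Equiv.sum_comp (Equiv.mulLeft g) f]
    exact Finset.sum_congr rfl fun x _ => h x
  have h2 : (c - 1) * ∑ x, f x = 0 := by linear_combination -h1
  exact (mul_eq_zero.1 h2).resolve_left (sub_ne_zero.2 hc)

variable {ι : Type*} [Fintype ι] [DecidableEq ι]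

noncomputable instance : Fintype (rootsOfUnity 4 ℂ) := Fintype.ofFinite _

/-- The complex number underlying a fourth root of unity. -/
noncomputable def phase (z : rootsOfUnity 4 ℂ) : ℂ := ((z : ℂˣ) : ℂ)

theorem phase_mul (z w : rootsOfUnity 4 ℂ) : phase (z * w) = phase z * phase w := rfl

@[simp] theorem phase_mul_star (z : rootsOfUnity 4 ℂ) : phase z * star (phase z) = 1 := by
  have h : ‖phase z‖ = 1 := Complex.norm_eq_one_of_mem_rootsOfUnity z.2
  have := Complex.mul_conj' (phase z)
  rw [h] at this
  simpa using this

theorem exists_phase_eq_I : ∃ z : rootsOfUnity 4 ℂ, phase z = Complex.I := by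
  refine ⟨⟨Units.mk0 Complex.I Complex.I_ne_zero, ?_⟩, rfl⟩
  rw [mem_rootsOfUnity]
  ext
  simp

/-- Only terms whose phases cancel survive. Signs would not suffice: the case a = d, b = c must
vanish, which needs phases whose square averages to zero. -/
theorem sum_phase_eq (a b c d : ι) :
    ∑ z : ι → rootsOfUnity 4 ℂ,
        phase (z a) * star (phase (z b)) * star (phase (z c) * star (phase (z d)))
      = (Fintype.card (ι → rootsOfUnity 4 ℂ) : ℂ) *
        if a = b then (if c = d then 1 else 0) else if a = c ∧ b = d then 1 else 0 := by
  obtain ⟨w, hw⟩ := exists_phase_eq_I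
  have key : ∀ (x y : ι) (z : ι → rootsOfUnity 4 ℂ), phase (((Pi.mulSingle x w : ι → rootsOfUnity 4 ℂ) * z) y)
      = if y = x then Complex.I * phase (z y) else phase (z y) := by
    intro x y z
    rw [Pi.mul_apply, phase_mul, Pi.mulSingle_apply]
    split_ifs
    · rw [hw]
    · simp [phase]
  have hI : Complex.I ≠ 1 := fun h => by simpa using congrArg Complex.re h
  have hI' : -Complex.I ≠ 1 := fun h => by simpa using congrArg Complex.re h
  by_cases hab : a = b
  · subst hab
    by_cases hcd : c = d
    · subst hcd
      simp only [phase_mul_star, star_one, mul_one, if_true, Finset.sum_const, Finset.card_univ,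
        nsmul_eq_mul]
    · simp only [phase_mul_star, one_mul, if_true, if_neg hcd, mul_zero]
      refine sum_eq_zero_of_translate (Pi.mulSingle c w : ι → rootsOfUnity 4 ℂ) hI' fun z => ?_
      simp only [key, if_true, if_neg (Ne.symm hcd), star_mul']
      simp; ring
  · by_cases hac : a = c
    · subst hac
      by_cases hbd : b = d
      · subst hbd
        have : ∀ z : ι → rootsOfUnity 4 ℂ, phase (z a) * star (phase (z b)) *
            star (phase (z a) * star (phase (z b))) = 1 := by
          intro z
          have h1 := phase_mul_star (z a)
          have h2 := phase_mul_star (z b)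
          rw [star_mul', star_star]
          linear_combination phase (z b) * star (phase (z b)) * h1 + h2
        simp only [this, hab, if_false, and_self, if_true, Finset.sum_const, Finset.card_univ,
          nsmul_eq_mul]
      · simp only [hab, hbd, if_false, and_false, mul_zero]
        refine sum_eq_zero_of_translate (Pi.mulSingle b w : ι → rootsOfUnity 4 ℂ) hI' fun z => ?_
        simp only [key, if_true, if_neg hab, if_neg (Ne.symm hbd), star_mul']
        simp; ring
    · simp only [hab, hac, if_false, false_and, mul_zero]
      by_cases had : d = a
      · subst had
        refine sum_eq_zero_of_translate (c := -1) (Pi.mulSingle d w : ι → rootsOfUnity 4 ℂ) (by norm_num) fun z => ?_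
        simp only [key, if_true, if_neg (Ne.symm hab), if_neg (Ne.symm hac), star_mul', star_star]
        linear_combination phase (z d) * star (phase (z b)) * (star (phase (z c)) * phase (z d))
          * Complex.I_mul_I
      · refine sum_eq_zero_of_translate (Pi.mulSingle a w : ι → rootsOfUnity 4 ℂ) hI fun z => ?_
        simp only [key, if_true, if_neg (Ne.symm hab), if_neg (Ne.symm hac), if_neg had]
        ring

/-- The complex number underlying a sign. -/
def signC (u : ℤˣ) : ℂ := ((u : ℤ) : ℂ)

@[simp] theorem signC_mul_self (u : ℤˣ) : signC u * signC u = 1 := by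
  rcases Int.units_eq_one_or u with rfl | rfl <;> simp [signC]

@[simp] theorem star_signC (u : ℤˣ) : star (signC u) = signC u := by simp [signC]

@[simp] theorem signC_neg (u : ℤˣ) : signC (-u) = -signC u := by simp [signC]

theorem signC_mul (u v : ℤˣ) : signC (u * v) = signC u * signC v := by simp [signC]

theorem sum_signC_mul (a b : ι) : ∑ e : ι → ℤˣ, signC (e a) * signC (e b)
    = (Fintype.card (ι → ℤˣ) : ℂ) * if a = b then 1 else 0 := by
  by_cases hab : a = b
  · subst hab; simp
  · rw [if_neg hab, mul_zero]
    refine sum_eq_zero_of_translate (c := -1) (Pi.mulSingle a (-1)) (by norm_num) fun e => ?_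
    simp [Ne.symm hab, signC]

theorem sum_signC (a : ι) : ∑ e : ι → ℤˣ, signC (e a) = 0 := by
  refine sum_eq_zero_of_translate (c := -1) (Pi.mulSingle a (-1)) (by norm_num) fun e => ?_
  simp [signC]

end Averages

/-! ### Symplectic pairings and the extreme points of the PPT region -/

/-- A fixed-point free involution of an index set with an antisymmetric choice of signs; the matrix
with entries `sign i` at `(i, partner i)` is a symplectic form. -/
structure SymplecticPairing (ι : Type*) where
  /-- The index paired with a given one. -/
  partner : ι → ι
  /-- The sign of an index. -/
  sign : ι → ℤˣ
  partner_partner : ∀ i, partner (partner i) = i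
  sign_partner : ∀ i, sign (partner i) = -sign i

namespace SymplecticPairing

variable {ι : Type*} (p : SymplecticPairing ι)

attribute [simp] partner_partner sign_partner

theorem partner_injective : Function.Injective p.partner :=
  Function.LeftInverse.injective p.partner_partner

@[simp] theorem partner_inj {i j : ι} : p.partner i = p.partner j ↔ i = j :=
  p.partner_injective.eq_iff

theorem partner_ne (i : ι) : p.partner i ≠ i := fun h => by
  have := p.sign_partner i
  rw [h] at this
  exact units_ne_neg_self _ this

theorem partner_eq_iff {i j : ι} : p.partner i = j ↔ i = p.partner j :=
  ⟨fun h => by rw [← h, partner_partner], fun h => by rw [h, partner_partner]⟩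

variable [DecidableEq ι]

/-- The unnormalised projection onto the maximally entangled vector. -/
def opJ (ι : Type*) [DecidableEq ι] : Matrix (ι × ι) (ι × ι) ℂ :=
  Matrix.of fun x y => if x.1 = x.2 ∧ y.1 = y.2 then 1 else 0

/-- The conjugate of the flip operator by the symplectic form acting on the second factor. -/
def opX : Matrix (ι × ι) (ι × ι) ℂ :=
  Matrix.of fun x y => if y.1 = p.partner x.2 ∧ y.2 = p.partner x.1 then
    -(signC (p.sign x.1) * signC (p.sign x.2)) else 0

theorem opJ_apply (x y : ι × ι) : opJ ι x y = if x.1 = x.2 ∧ y.1 = y.2 then 1 else 0 := rfl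

theorem opX_apply (x y : ι × ι) : p.opX x y =
    if y.1 = p.partner x.2 ∧ y.2 = p.partner x.1 then
      -(signC (p.sign x.1) * signC (p.sign x.2)) else 0 := rfl

theorem one_apply_prod (x y : ι × ι) :
    (1 : Matrix (ι × ι) (ι × ι) ℂ) x y = if x.1 = y.1 ∧ x.2 = y.2 then 1 else 0 := by
  simp only [Matrix.one_apply, Prod.ext_iff]

variable [Fintype ι]

/-- The average of z ⊗ z̄ over random phases has entry 1 where the phases pair up in the pattern of
J or of the identity. Where both patterns hold it counts once instead of twice; the projections onto
|aa⟩ make up the deficit. -/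
theorem one_add_opJ_mem : 1 + opJ ι ∈ productCone ι ι := by
  let N : ℝ := Fintype.card (ι → rootsOfUnity 4 ℂ)
  have hN : N ≠ 0 := by simp [N]
  have h : 1 + opJ ι = N⁻¹ • ∑ z : ι → rootsOfUnity 4 ℂ,
        ketbra (tensorVec (WithLp.toLp 2 fun a => phase (z a))
          (WithLp.toLp 2 fun a => star (phase (z a))))
      + ∑ a : ι, ketbra (tensorVec (EuclideanSpace.single a 1) (EuclideanSpace.single a 1)) := by
    ext ⟨a, b⟩ ⟨c, d⟩
    simp only [Matrix.add_apply, Matrix.smul_apply, Matrix.sum_apply, ketbra_apply,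
      tensorVec_apply, one_apply_prod, opJ_apply]
    rw [sum_phase_eq, Complex.real_smul, ← mul_assoc]
    have hN' : ((N⁻¹ : ℝ) : ℂ) * (Fintype.card (ι → rootsOfUnity 4 ℂ) : ℂ) = 1 := by
      rw [Complex.ofReal_inv]
      exact inv_mul_cancel₀ (by exact_mod_cast hN)
    rw [hN', one_mul]
    have h2 : ∑ x : ι, (EuclideanSpace.single x (1 : ℂ)) a * (EuclideanSpace.single x (1 : ℂ)) b
        * star ((EuclideanSpace.single x (1 : ℂ)) c * (EuclideanSpace.single x (1 : ℂ)) d)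
        = if b = a ∧ c = a ∧ d = a then 1 else 0 := by
      rw [Finset.sum_eq_single a]
      · by_cases h1 : b = a <;> by_cases h2 : c = a <;> by_cases h3 : d = a <;>
          simp [PiLp.single_apply, h1, h2, h3]
      · intro x _ hx
        simp [PiLp.single_apply, Ne.symm hx]
      · simp
    rw [h2]
    clear hN' h2
    grind
  rw [h]
  exact add_mem (PointedCone.smul_mem _ (inv_nonneg.2 (Nat.cast_nonneg _))
    (Submodule.sum_mem _ fun _ _ => ketbra_mem_productCone _ _))
    (Submodule.sum_mem _ fun _ _ => ketbra_mem_productCone _ _)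

/-- The vector `Ω w̄`. -/
noncomputable def conjOmega (w : EuclideanSpace ℂ ι) : EuclideanSpace ℂ ι :=
  WithLp.toLp 2 fun b => signC (p.sign b) * star (w (p.partner b))

/-- The map `id ⊗ (Z ↦ Ω Zᵀ Ω^*)`. -/
def sympTranspose : Matrix (ι × ι) (ι × ι) ℂ →ₗ[ℝ] Matrix (ι × ι) (ι × ι) ℂ where
  toFun ρ := Matrix.of fun x y => signC (p.sign x.2) * signC (p.sign y.2) *
    ρ (x.1, p.partner y.2) (y.1, p.partner x.2)
  map_add' ρ σ := by ext x y; simp [mul_add]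
  map_smul' c ρ := by ext x y; simp; ring

omit [Fintype ι] [DecidableEq ι] in
theorem sympTranspose_apply (ρ : Matrix (ι × ι) (ι × ι) ℂ) (x y : ι × ι) :
    p.sympTranspose ρ x y = signC (p.sign x.2) * signC (p.sign y.2) *
      ρ (x.1, p.partner y.2) (y.1, p.partner x.2) := rfl

omit [Fintype ι] [DecidableEq ι] in
theorem sympTranspose_ketbra (v w : EuclideanSpace ℂ ι) :
    p.sympTranspose (ketbra (tensorVec v w)) = ketbra (tensorVec v (p.conjOmega w)) := by
  ext x y
  simp [sympTranspose_apply, conjOmega]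
  ring

omit [Fintype ι] in
theorem sympTranspose_opJ : p.sympTranspose (opJ ι) = p.opX := by
  ext ⟨a, b⟩ ⟨c, d⟩
  simp only [sympTranspose_apply, opJ_apply, opX_apply]
  by_cases h : a = p.partner d ∧ c = p.partner b
  · obtain ⟨rfl, rfl⟩ := h
    simp; ring
  · rw [if_neg h, if_neg (fun h' => h ⟨by rw [h'.2, partner_partner], h'.1⟩), mul_zero]

omit [Fintype ι] in
theorem sympTranspose_one : p.sympTranspose (1 : Matrix (ι × ι) (ι × ι) ℂ) = 1 := by
  ext ⟨a, b⟩ ⟨c, d⟩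
  simp only [sympTranspose_apply, one_apply_prod, partner_inj]
  by_cases h : b = d
  · subst h; simp
  · simp [h, Ne.symm h]

/-- The twisted partial transpose fixes the identity, sends J to X and sends product projections to
product projections. -/
theorem one_add_opX_mem : 1 + p.opX ∈ productCone ι ι := by
  have := map_mem_productCone p.sympTranspose (fun v w => by
    rw [sympTranspose_ketbra]; exact ketbra_mem_productCone _ _) (one_add_opJ_mem (ι := ι))
  rwa [map_add, sympTranspose_one, sympTranspose_opJ] at this

/-- The map `id ⊗ (Z ↦ tr Z • 1)`. -/
def traceMap : Matrix (ι × ι) (ι × ι) ℂ →ₗ[ℝ] Matrix (ι × ι) (ι × ι) ℂ where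
  toFun ρ := Matrix.of fun x y => if x.2 = y.2 then ∑ e, ρ (x.1, e) (y.1, e) else 0
  map_add' ρ σ := by
    ext x y; simp only [Matrix.of_apply, Matrix.add_apply, Finset.sum_add_distrib]
    split_ifs <;> simp
  map_smul' c ρ := by
    ext x y
    simp only [Matrix.of_apply, Matrix.smul_apply, RingHom.id_apply]
    split_ifs <;> simp [Finset.mul_sum]

theorem traceMap_apply (ρ : Matrix (ι × ι) (ι × ι) ℂ) (x y : ι × ι) :
    traceMap ρ x y = if x.2 = y.2 then ∑ e, ρ (x.1, e) (y.1, e) else 0 := rfl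

theorem traceMap_one : traceMap (1 : Matrix (ι × ι) (ι × ι) ℂ) = (Fintype.card ι : ℝ) • 1 := by
  ext ⟨a, b⟩ ⟨c, d⟩
  simp only [traceMap_apply, one_apply_prod, Matrix.smul_apply]
  by_cases h : b = d <;> by_cases h' : a = c <;> simp [h, h']

theorem traceMap_opJ : traceMap (opJ ι) = 1 := by
  ext ⟨a, b⟩ ⟨c, d⟩
  simp only [traceMap_apply, one_apply_prod, opJ_apply]
  by_cases h : b = d <;> by_cases h' : a = c
  · subst h h'; simp
  · subst h; simp only [h', if_true, and_true, if_false]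
    refine Finset.sum_eq_zero fun e _ => if_neg fun h => h' (h.1.trans h.2.symm)
  · simp [h]
  · simp [h]

/-- The Breuer-Hall operator `‖w‖² - |w⟩⟨w| - |Ωw̄⟩⟨Ωw̄|`. -/
noncomputable def breuerHall (w : EuclideanSpace ℂ ι) : Matrix ι ι ℂ :=
  (∑ e, w e * star (w e)) • 1 - ketbra w - ketbra (p.conjOmega w)

/-- Since Ω is antisymmetric and isometric, Ωw̄ is orthogonal to w and has the same norm. The
operator is therefore ‖w‖² times a projection, hence positive. -/
theorem breuerHall_sq (w : EuclideanSpace ℂ ι) :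
    (p.breuerHall w).conjTranspose * p.breuerHall w
      = (∑ e, w e * star (w e)) • p.breuerHall w := by
  set r := ∑ e, w e * star (w e) with hr
  set u := p.conjOmega w with hu
  have hswap : ∀ f : ι → ℂ, ∑ e, f (p.partner e) = ∑ e, f e := fun f =>
    (Equiv.ofBijective p.partner (Finite.injective_iff_bijective.1 p.partner_injective)).sum_comp f
  have h0 : ∀ e, u e = signC (p.sign e) * star (w (p.partner e)) := fun e => rfl
  have hru : ∑ e, u e * star (u e) = r := by
    rw [hr, ← hswap fun e => w e * star (w e)]
    refine Finset.sum_congr rfl fun e _ => ?_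
    have := signC_mul_self (p.sign e)
    simp only [h0, star_mul', star_star, star_signC]
    linear_combination star (w (p.partner e)) * w (p.partner e) * this
  have huw : ∑ e, u e * star (w e) = 0 := by
    have h1 : ∑ e, u e * star (w e) = -∑ e, u e * star (w e) := by
      conv_lhs => rw [← hswap]
      rw [← Finset.sum_neg_distrib]
      refine Finset.sum_congr rfl fun e _ => ?_
      simp only [h0, sign_partner, partner_partner, signC_neg]
      ring
    linear_combination (1 / 2 : ℂ) * h1
  have hwu : ∑ e, w e * star (u e) = 0 := by
    have := congrArg star huw
    simpa [mul_comm] using this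
  have hmul : ∀ x y : EuclideanSpace ℂ ι, ketbra x * ketbra y
      = (∑ e, y e * star (x e)) • Matrix.of fun i j => x i * star (y j) := by
    intro x y
    ext i j
    simp only [Matrix.mul_apply, ketbra_apply, Matrix.smul_apply, Matrix.of_apply, smul_eq_mul,
      Finset.sum_mul]
    exact Finset.sum_congr rfl fun e _ => by ring
  have hrs : star r = r := by simp [hr, mul_comm]
  have hH : (p.breuerHall w).conjTranspose = p.breuerHall w := by
    simp only [breuerHall, Matrix.conjTranspose_sub, Matrix.conjTranspose_smul,
      Matrix.conjTranspose_one, (ketbra_posSemidef _).1.eq, ← hr, hrs]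
  rw [hH, breuerHall, ← hr, ← hu]
  have h1 : ketbra w * ketbra w = r • ketbra w := hmul w w
  have h2 : ketbra u * ketbra u = r • ketbra u := by rw [hmul, hru]; rfl
  have h3 : ketbra w * ketbra u = 0 := by rw [hmul, huw, zero_smul]
  have h4 : ketbra u * ketbra w = 0 := by rw [hmul, hwu, zero_smul]
  simp only [sub_mul, mul_sub, h1, h2, h3, h4, smul_mul_assoc, mul_smul_comm, one_mul, mul_one,
    smul_sub]
  abel

theorem kronecker_breuerHall_mem (v w : EuclideanSpace ℂ ι) :
    ketbra v ⊗ₖ p.breuerHall w ∈ productCone ι ι := by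
  set r : ℝ := ‖w‖ ^ 2 with hr
  have h1 : ∑ e, w e * star (w e) = (r : ℂ) := (trace_ketbra w).symm ▸ rfl
  by_cases h0 : w = 0
  · have : ketbra v ⊗ₖ p.breuerHall w = 0 := by
      ext x y
      simp [breuerHall, h0, conjOmega]
    rw [this]
    exact Submodule.zero_mem _
  · have hr0 : 0 < r := by
      have := norm_pos_iff.2 h0
      positivity
    have h2 : ketbra v ⊗ₖ p.breuerHall w
        = r⁻¹ • (ketbra v ⊗ₖ ((p.breuerHall w).conjTranspose * p.breuerHall w)) := by
      rw [breuerHall_sq, h1]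
      ext x y
      simp only [Matrix.kroneckerMap_apply, Matrix.smul_apply, Complex.real_smul, smul_eq_mul]
      have : (r : ℂ) ≠ 0 := by exact_mod_cast hr0.ne'
      push_cast
      field_simp
    rw [h2]
    exact PointedCone.smul_mem _ (by positivity) (ketbra_kronecker_mem_productCone _ _)

/-- Apply the map Z ↦ tr(Z)·1 - Z - ΩZᵀΩ* on the second factor to 1 + J: positivity of this map
keeps product projections in the separable cone, and the image is (d+1)·1 - (1 + J) - (1 + X). -/
theorem breuerHall_extreme_mem :
    ((Fintype.card ι : ℝ) - 1) • (1 : Matrix (ι × ι) (ι × ι) ℂ) - opJ ι - p.opX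
      ∈ productCone ι ι := by
  have := map_mem_productCone (traceMap - LinearMap.id - p.sympTranspose) (fun v w => by
    have h : (traceMap - LinearMap.id - p.sympTranspose : _ →ₗ[ℝ] _) (ketbra (tensorVec v w))
        = ketbra v ⊗ₖ p.breuerHall w := by
      simp only [LinearMap.sub_apply, LinearMap.id_apply, sympTranspose_ketbra]
      ext ⟨a, b⟩ ⟨c, d⟩
      simp only [Matrix.sub_apply, traceMap_apply, ketbra_apply, tensorVec_apply,
        Matrix.kronecker_apply, breuerHall, Matrix.smul_apply, Matrix.one_apply, smul_eq_mul,
        star_mul']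
      have : ∑ e, v a * w e * (star (v c) * star (w e))
          = v a * star (v c) * ∑ e, w e * star (w e) := by
        rw [Finset.mul_sum]
        exact Finset.sum_congr rfl fun e _ => by ring
      rw [this]
      split_ifs <;> ring
    rw [h]
    exact p.kronecker_breuerHall_mem v w) (one_add_opJ_mem (ι := ι))
  convert this using 1
  simp only [LinearMap.sub_apply, LinearMap.id_apply, map_add, traceMap_one, traceMap_opJ,
    sympTranspose_one, sympTranspose_opJ, sub_smul, one_smul]
  abel

end SymplecticPairing

namespace SymplecticPairing

/-! ### Operators in the cones of Schmidt number `n` and `n - 1` -/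

variable {ι : Type*} [DecidableEq ι] (p : SymplecticPairing ι)

/-- The representative of the pair of an index having sign `1`. -/
def rep (a : ι) : ι := if p.sign a = 1 then a else p.partner a

omit [DecidableEq ι] in
theorem rep_eq_rep_iff {a c : ι} : p.rep a = p.rep c ↔ c = a ∨ c = p.partner a := by
  have h1 := p.sign_partner a
  have h2 := p.sign_partner c
  have h3 := p.partner_partner a
  have h4 := p.partner_partner c
  have h5 : (-1 : ℤˣ) ≠ 1 := by decide
  have h6 : -(-1 : ℤˣ) = 1 := by decide
  rcases Int.units_eq_one_or (p.sign a) with ha | ha <;>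
    rcases Int.units_eq_one_or (p.sign c) with hc | hc <;>
    simp only [rep, ha, hc] <;> grind

omit [DecidableEq ι] in
theorem sign_rep (a : ι) : p.sign (p.rep a) = 1 := by
  rcases Int.units_eq_one_or (p.sign a) with ha | ha <;> simp [rep, ha]

/-- The dual `(τ b, τ a)` of a pair of indices `(a, b)`. -/
def dual (x : ι × ι) : ι × ι := (p.partner x.2, p.partner x.1)

omit [DecidableEq ι] in
@[simp] theorem dual_dual (x : ι × ι) : p.dual (p.dual x) = x := by simp [dual]

/-- The coefficient of `opX` at a pair of indices. -/
def coef (x : ι × ι) : ℂ := -(signC (p.sign x.1) * signC (p.sign x.2))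

omit [DecidableEq ι] in
@[simp] theorem coef_dual (x : ι × ι) : p.coef (p.dual x) = p.coef x := by
  simp [coef, dual, mul_comm]

omit [DecidableEq ι] in
@[simp] theorem coef_mul_self (x : ι × ι) : p.coef x * p.coef x = 1 := by
  have h1 := signC_mul_self (p.sign x.1)
  have h2 := signC_mul_self (p.sign x.2)
  simp only [coef]
  linear_combination signC (p.sign x.2) * signC (p.sign x.2) * h1 + h2

omit [DecidableEq ι] in
@[simp] theorem star_coef (x : ι × ι) : star (p.coef x) = p.coef x := by simp [coef]

theorem opX_apply' (x y : ι × ι) : p.opX x y = if y = p.dual x then p.coef x else 0 := by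
  simp only [opX_apply, dual, coef, Prod.ext_iff]

/-- The restriction of an operator to the rows satisfying a predicate. -/
def restrict (q : ι → ι → Prop) [∀ a b, Decidable (q a b)] (ρ : Matrix (ι × ι) (ι × ι) ℂ) :
    Matrix (ι × ι) (ι × ι) ℂ :=
  Matrix.of fun x y => if q x.1 x.2 then ρ x y else 0

omit [DecidableEq ι] in
theorem restrict_apply (q : ι → ι → Prop) [∀ a b, Decidable (q a b)]
    (ρ : Matrix (ι × ι) (ι × ι) ℂ) (x y : ι × ι) :
    restrict q ρ x y = if q x.1 x.2 then ρ x y else 0 := rfl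

variable [Fintype ι]

/-- The compression of `1 + opX` to matrix units in a set stable under duality is a sum of
projections onto vectors of Schmidt rank at most two. -/
theorem restrict_one_add_opX_mem {k : ℕ} (hk : 2 ≤ k) (q : ι → ι → Prop)
    [∀ a b, Decidable (q a b)] (hq : ∀ a b, q (p.partner b) (p.partner a) ↔ q a b) :
    restrict q (1 + p.opX) ∈ schmidtCone ι ι k := by
  -- The vector (1 + X)e_z, a sum of two product vectors. As X² = 1, one has (1 + X)² = 2(1 + X), so
  -- half the sum of these projections is 1 + X; the restriction is compatible because `q` is stable
  -- under duality.
  let f : ι × ι → EuclideanSpace ℂ (ι × ι) := fun z => ∑ i : Bool,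
    tensorVec (EuclideanSpace.single (if i then z.1 else p.partner z.2) (1 : ℂ))
      (EuclideanSpace.single (if i then z.2 else p.partner z.1) (if i then 1 else p.coef z))
  have hf : ∀ z x, f z x = (if z = x then 1 else 0) + (if z = p.dual x then p.coef x else 0) := by
    intro z x
    have hz : z = p.dual x ↔ x.1 = p.partner z.2 ∧ x.2 = p.partner z.1 := by
      simp only [dual, Prod.ext_iff, eq_comm (a := x.1), eq_comm (a := x.2), partner_eq_iff]
      tauto
    have hz' : z = x ↔ x.1 = z.1 ∧ x.2 = z.2 := by
      simp only [Prod.ext_iff, eq_comm]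
    simp only [f, Fintype.sum_bool, PiLp.add_apply, tensorVec_apply, PiLp.single_apply, hz']
    congr 1
    · by_cases h1 : x.1 = z.1 <;> by_cases h2 : x.2 = z.2 <;> simp [h1, h2]
    · by_cases h : z = p.dual x
      · rw [if_pos h]
        have h' := hz.1 h
        simp [h'.1, h'.2, h]
      · rw [if_neg h]
        rw [hz] at h
        by_cases h1 : x.1 = p.partner z.2 <;> by_cases h2 : x.2 = p.partner z.1 <;> simp_all
  have h : restrict q (1 + p.opX)
      = (2⁻¹ : ℝ) • ∑ z : ι × ι, (if q z.1 z.2 then (1 : ℝ) else 0) • ketbra (f z) := by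
    ext x y
    have hqx : q (p.dual x).1 (p.dual x).2 ↔ q x.1 x.2 := hq _ _
    have h1 : ∀ z, ((if q z.1 z.2 then (1 : ℝ) else 0) • ketbra (f z)) x y
        = (if z = x then (if q x.1 x.2 then star (f x y) else 0) else 0)
          + (if z = p.dual x then (if q x.1 x.2 then p.coef x * star (f (p.dual x) y) else 0)
            else 0) := by
      intro z
      rw [Matrix.smul_apply, ketbra_apply, hf z x]
      by_cases h1 : z = x
      · subst h1
        by_cases h2 : z = p.dual z
        · rw [← h2]
          by_cases h3 : q z.1 z.2 <;> simp [h3, add_mul]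
        · by_cases h3 : q z.1 z.2 <;> simp [h2, h3]
      · by_cases h2 : z = p.dual x
        · subst h2
          simp only [h1, if_false, if_true, zero_add, hqx]
          by_cases h3 : q x.1 x.2 <;> simp [h3]
        · simp [h1, h2]
    rw [Matrix.smul_apply, Matrix.sum_apply, Finset.sum_congr rfl fun z _ => h1 z,
      Finset.sum_add_distrib, Finset.sum_ite_eq' Finset.univ x,
      Finset.sum_ite_eq' Finset.univ (p.dual x), restrict_apply]
    simp only [Finset.mem_univ, if_true]
    by_cases h3 : q x.1 x.2
    · simp only [h3, if_true, Matrix.add_apply, opX_apply', Matrix.one_apply, Complex.real_smul, hf]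
      have hyx : y = p.dual x ↔ x = p.dual y :=
        ⟨fun h => by rw [h, dual_dual], fun h => by rw [h, dual_dual]⟩
      have hyx' : p.dual x = p.dual y ↔ x = y :=
        ⟨fun h => by rw [← p.dual_dual x, h, dual_dual], fun h => by rw [h]⟩
      simp only [eq_comm (a := p.dual x) (b := y), hyx, hyx', star_add]
      have hc := p.coef_mul_self x
      by_cases h4 : x = y <;> by_cases h5 : x = p.dual y
      · subst h4; simp only [← h5, if_true, star_one, star_coef]
        push_cast
        linear_combination -(1 / 2 : ℂ) * hc
      · subst h4; simp only [h5, if_true, if_false, star_one, star_coef, star_zero]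
        push_cast
        linear_combination -(1 / 2 : ℂ) * hc
      · have : p.coef y = p.coef x := by rw [h5, coef_dual]
        simp only [if_neg h4, if_pos h5, star_one, star_coef, star_zero, this]
        push_cast
        ring
      · simp [h4, h5]
    · simp [h3]
  rw [h]
  refine PointedCone.smul_mem _ (by norm_num) (Submodule.sum_mem _ fun z _ =>
    PointedCone.smul_mem _ (by split_ifs <;> norm_num) ?_)
  exact ketbra_sum_mem_schmidtCone (Finset.univ : Finset Bool) (by simpa using hk) _ _

/-- A transversal of the pairs, selected by a choice of signs. -/
def transversal (e : ι → ℤˣ) : Finset ι := Finset.univ.filter fun a => p.sign a * e (p.rep a) = 1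

omit [DecidableEq ι] in
theorem partner_mem_transversal (e : ι → ℤˣ) (a : ι) :
    p.partner a ∈ p.transversal e ↔ a ∉ p.transversal e := by
  have h : p.rep (p.partner a) = p.rep a := p.rep_eq_rep_iff.2 (by simp)
  simp only [transversal, Finset.mem_filter, Finset.mem_univ, true_and, h, sign_partner]
  have h5 : (1 : ℤˣ) ≠ -1 := by decide
  rcases Int.units_eq_one_or (p.sign a * e (p.rep a)) with h1 | h1 <;> simp [h1, h5.symm]

omit [DecidableEq ι] in
theorem card_transversal (e : ι → ℤˣ) {n : ℕ} (hn : Fintype.card ι = 2 * n) :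
    (p.transversal e).card = n := by
  classical
  have h1 : (p.transversal e).card = ((p.transversal e)ᶜ).card := by
    refine Finset.card_bij (fun a _ => p.partner a) (fun a ha => ?_)
      (fun a _ b _ h => p.partner_injective h) (fun b hb => ⟨p.partner b, ?_, by simp⟩)
    · rw [Finset.mem_compl, partner_mem_transversal, not_not]; exact ha
    · rw [partner_mem_transversal]; exact Finset.mem_compl.1 hb
  have h2 := Finset.card_compl_add_card (p.transversal e)
  omega

/-- The indicator function of a transversal. -/
noncomputable def ind (e : ι → ℤˣ) (a : ι) : ℂ := if a ∈ p.transversal e then 1 else 0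

/-- Being affine in the random signs, the indicator has second moments that reduce to those of
independent signs. -/
theorem ind_eq (e : ι → ℤˣ) (a : ι) :
    p.ind e a = (1 + signC (p.sign a) * signC (e (p.rep a))) / 2 := by
  have h5 : (-1 : ℤˣ) ≠ 1 := by decide
  rw [← signC_mul, ind]
  simp only [transversal, Finset.mem_filter, Finset.mem_univ, true_and]
  rcases Int.units_eq_one_or (p.sign a * e (p.rep a)) with h1 | h1 <;> simp [h1, h5, signC]

@[simp] theorem star_ind (e : ι → ℤˣ) (a : ι) : star (p.ind e a) = p.ind e a := by
  simp only [ind]; split_ifs <;> simp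

/-- A random transversal contains a given index with probability 1/2, never both members of a pair,
and indices of different pairs independently. -/
theorem sum_ind_mul_ind (a c : ι) : ∑ e : ι → ℤˣ, p.ind e a * p.ind e c
    = (Fintype.card (ι → ℤˣ) : ℂ) / 4 *
      if c = a then 2 else if c = p.partner a then 0 else 1 := by
  have h1 : ∀ e : ι → ℤˣ, p.ind e a * p.ind e c
      = 1 / 4 + signC (p.sign a) / 4 * signC (e (p.rep a))
        + signC (p.sign c) / 4 * signC (e (p.rep c))
        + signC (p.sign a) * signC (p.sign c) / 4 *
          (signC (e (p.rep a)) * signC (e (p.rep c))) := by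
    intro e
    rw [ind_eq, ind_eq]
    ring
  simp only [h1, Finset.sum_add_distrib, ← Finset.mul_sum, sum_signC, sum_signC_mul,
    Finset.sum_const, Finset.card_univ, nsmul_eq_mul, rep_eq_rep_iff]
  by_cases h2 : c = a
  · subst h2
    have := signC_mul_self (p.sign c)
    simp only [true_or, if_true, mul_zero, add_zero, mul_one]
    linear_combination (Fintype.card (ι → ℤˣ) : ℂ) / 4 * this
  · by_cases h3 : c = p.partner a
    · have := signC_mul_self (p.sign a)
      subst h3
      simp only [h2, if_true, if_false, or_true, sign_partner, signC_neg]
      linear_combination -(Fintype.card (ι → ℤˣ) : ℂ) / 4 * this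
    · simp only [h2, h3, if_false, or_self]
      ring

theorem inv_card_mul_card {κ : Type*} [Fintype κ] [Nonempty κ] :
    (((Fintype.card κ : ℝ)⁻¹ : ℝ) : ℂ) * (Fintype.card κ : ℂ) = 1 := by
  rw [Complex.ofReal_inv]
  exact inv_mul_cancel₀ (by simp)

/-- Averaging projections onto transversals. -/
theorem opJ_add_restrict_mem {n : ℕ} (hn : Fintype.card ι = 2 * n) :
    opJ ι + restrict (· = ·) (1 + p.opX) ∈ schmidtCone ι ι n := by
  -- The joint probabilities 1/2, 0, 1/4, scaled by 4, become 2, 0, 1: the entry 1 of J, corrected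
  -- by +1 from the identity or by -1 from X.
  have h : opJ ι + restrict (· = ·) (1 + p.opX)
      = (4 * (Fintype.card (ι → ℤˣ) : ℝ)⁻¹) • ∑ e : ι → ℤˣ, ketbra (∑ a ∈ p.transversal e,
        tensorVec (EuclideanSpace.single a (1 : ℂ)) (EuclideanSpace.single a (1 : ℂ))) := by
    have h1 : ∀ (e : ι → ℤˣ) (x : ι × ι), (∑ a ∈ p.transversal e,
        tensorVec (EuclideanSpace.single a (1 : ℂ)) (EuclideanSpace.single a (1 : ℂ))) x
        = if x.1 = x.2 then p.ind e x.1 else 0 := by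
      intro e x
      simp only [WithLp.ofLp_sum, Finset.sum_apply, tensorVec_apply, PiLp.single_apply,
        ite_mul, one_mul, zero_mul, Finset.sum_ite_eq, ind]
      by_cases h : x.1 = x.2
      · simp [h]
      · simp [h, Ne.symm h]
    ext ⟨a, b⟩ ⟨c, d⟩
    simp only [Matrix.add_apply, Matrix.smul_apply, Matrix.sum_apply, ketbra_apply, h1]
    by_cases hab : a = b
    · by_cases hcd : c = d
      · subst hab hcd
        simp only [if_true, star_ind, sum_ind_mul_ind, Complex.real_smul]
        push_cast
        have := inv_card_mul_card (κ := ι → ℤˣ)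
        rw [Complex.ofReal_inv, Complex.ofReal_natCast] at this
        simp only [restrict_apply, opJ_apply, opX_apply, Matrix.add_apply, one_apply_prod,
          signC_mul_self, and_self, if_true, eq_comm (a := a) (b := c)]
        have hne := p.partner_ne a
        by_cases h2 : c = a
        · subst h2
          simp only [if_true, if_neg (Ne.symm hne)]
          linear_combination -2 * this
        · by_cases h3 : c = p.partner a
          · simp [h3, hne]
          · simp only [h2, h3, if_false]
            linear_combination -this
      · subst hab
        have h3 : ¬(c = p.partner a ∧ d = p.partner a) := fun h => hcd (h.1.trans h.2.symm)
        have h4 : ¬(a = c ∧ a = d) := fun h => hcd (h.1.symm.trans h.2)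
        simp [restrict_apply, opJ_apply, opX_apply, hcd, h3, h4]
    · simp [restrict_apply, opJ_apply, hab]
  rw [h]
  exact PointedCone.smul_mem _ (by positivity) (Submodule.sum_mem _ fun e _ =>
    ketbra_sum_mem_schmidtCone _ (p.card_transversal e hn).le _ _)

/-- Transversals supply J and the rows (a, a), using Schmidt rank at most n; the remaining rows of 1
+ X need only rank two. -/
theorem one_add_opJ_add_opX_mem {n : ℕ} (hn : Fintype.card ι = 2 * n) (hn2 : 2 ≤ n) :
    1 + opJ ι + p.opX ∈ schmidtCone ι ι n := by
  have h := add_mem (p.opJ_add_restrict_mem hn)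
    (p.restrict_one_add_opX_mem hn2 (· ≠ ·) fun a b => by simp [eq_comm])
  convert h using 1
  ext x y
  simp only [Matrix.add_apply, restrict_apply]
  by_cases h : x.1 = x.2 <;> simp [h] <;> ring

end SymplecticPairing

/-! ### Corank-one projections supported on transversals -/

namespace SymplecticPairing

variable {ι : Type*} [DecidableEq ι]

theorem sum_phase_mul_star [Fintype ι] (a b : ι) :
    ∑ z : ι → rootsOfUnity 4 ℂ, phase (z a) * star (phase (z b))
      = (Fintype.card (ι → rootsOfUnity 4 ℂ) : ℂ) * if a = b then 1 else 0 := by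
  have h := sum_phase_eq a b a a
  simp only [phase_mul_star, star_one, mul_one, if_true] at h
  rw [h]
  by_cases hab : a = b
  · simp [hab]
  · simp [hab, Ne.symm hab]

/-- The coefficient matrix of the projection of the coordinate subspace of `t` onto the complement
of a vector with unimodular entries. -/
noncomputable def phaseProj (t : Finset ι) (z : ι → rootsOfUnity 4 ℂ) :
    EuclideanSpace ℂ (ι × ι) :=
  WithLp.toLp 2 fun x => if x.1 ∈ t ∧ x.2 ∈ t then
    (if x.1 = x.2 then 1 else 0) - phase (z x.1) * star (phase (z x.2)) / (t.card : ℂ) else 0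

/-- The projection kills the phase vector, so its rows, weighted by phases, sum to zero. Subtracting
the `a₀` term from the left factors then costs nothing and removes one summand. -/
theorem phaseProj_eq_sum {t : Finset ι} {a₀ : ι} (h₀ : a₀ ∈ t) (z : ι → rootsOfUnity 4 ℂ) :
    phaseProj t z = ∑ a ∈ t.erase a₀, tensorVec
      (WithLp.toLp 2 fun x => (if x = a then phase (z a) else 0)
        - (if x = a₀ then phase (z a₀) else 0))
      (WithLp.toLp 2 fun x => (if x = a then star (phase (z a)) else 0)
        - (if x ∈ t then star (phase (z x)) / (t.card : ℂ) else 0)) := by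
  have hc : (t.card : ℂ) ≠ 0 := by
    exact_mod_cast (Finset.card_pos.2 ⟨a₀, h₀⟩).ne'
  ext ⟨x, y⟩
  simp only [phaseProj, WithLp.ofLp_sum, Finset.sum_apply, tensorVec_apply]
  have hw : ∑ a ∈ t, ((if y = a then star (phase (z a)) else 0)
      - (if y ∈ t then star (phase (z y)) / (t.card : ℂ) else 0)) = 0 := by
    rw [Finset.sum_sub_distrib, Finset.sum_ite_eq, Finset.sum_const, nsmul_eq_mul]
    by_cases hy : y ∈ t
    · simp only [hy, if_true]
      field_simp
      simp
    · simp [hy]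
  rw [Finset.sum_erase _ (by simp)]
  simp only [sub_mul _ _ (_ - _)]
  rw [Finset.sum_sub_distrib, ← Finset.mul_sum, hw, mul_zero, sub_zero]
  simp only [ite_mul, zero_mul, Finset.sum_ite_eq]
  have h1 := phase_mul_star (z x)
  by_cases hx : x ∈ t
  · by_cases hxy : y = x
    · subst hxy
      simp only [hx, and_self, if_true]
      rw [mul_sub, h1, ← mul_div_assoc, h1]
    · by_cases hy : y ∈ t
      · simp only [hx, hy, and_self, if_true, hxy, Ne.symm hxy, if_false]
        ring
      · simp [hy, hxy]
  · simp [hx]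

/-- Averaging projections of corank one inside a coordinate subspace. -/
theorem average_phaseProj_mem [Fintype ι] {t : Finset ι} {n : ℕ} (ht : t.card = n) (hn : 1 ≤ n) :
    Matrix.of (fun x y : ι × ι =>
      (if x.1 = x.2 ∧ y.1 = y.2 ∧ x.1 ∈ t ∧ y.1 ∈ t then ((n : ℂ) - 1) ^ 2 else 0)
        + (if x.1 ≠ x.2 ∧ x = y ∧ x.1 ∈ t ∧ x.2 ∈ t then 1 else 0)) ∈ schmidtCone ι ι (n - 1) := by
  -- Diagonal entries of the projection are 1 - 1/n and off-diagonal ones are -z_a z̄_b/n; the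
  -- factor n² turns the second moments into (n-1)² and 1.
  have h : Matrix.of (fun x y : ι × ι =>
      (if x.1 = x.2 ∧ y.1 = y.2 ∧ x.1 ∈ t ∧ y.1 ∈ t then ((n : ℂ) - 1) ^ 2 else 0)
        + (if x.1 ≠ x.2 ∧ x = y ∧ x.1 ∈ t ∧ x.2 ∈ t then 1 else 0))
      = ((n : ℝ) ^ 2 * (Fintype.card (ι → rootsOfUnity 4 ℂ) : ℝ)⁻¹) •
        ∑ z : ι → rootsOfUnity 4 ℂ, ketbra (phaseProj t z) := by
    ext ⟨a, b⟩ ⟨c, d⟩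
    simp only [Matrix.of_apply, Matrix.smul_apply, Matrix.sum_apply, ketbra_apply, phaseProj, ht]
    by_cases hab : a ∈ t ∧ b ∈ t
    · by_cases hcd : c ∈ t ∧ d ∈ t
      · have hn0 : (n : ℂ) ≠ 0 := by exact_mod_cast (by omega : n ≠ 0)
        simp only [hab, hcd, and_self, if_true]
        have h1 : ∀ z : ι → rootsOfUnity 4 ℂ,
            ((if a = b then 1 else 0) - phase (z a) * star (phase (z b)) / (n : ℂ)) *
              star ((if c = d then 1 else 0) - phase (z c) * star (phase (z d)) / (n : ℂ))
            = (if a = b then 1 else 0) * (if c = d then 1 else 0)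
              - (if a = b then 1 else 0) / (n : ℂ) * (phase (z d) * star (phase (z c)))
              - (if c = d then 1 else 0) / (n : ℂ) * (phase (z a) * star (phase (z b)))
              + 1 / (n : ℂ) ^ 2 * (phase (z a) * star (phase (z b)) *
                star (phase (z c) * star (phase (z d)))) := by
          intro z
          have h2 : star ((if c = d then (1 : ℂ) else 0)) = if c = d then 1 else 0 := by
            split_ifs <;> simp
          rw [star_sub, h2, star_div₀, star_mul', star_star, star_natCast]
          field_simp
          ring
        rw [Finset.sum_congr rfl fun z _ => h1 z]
        simp only [Finset.sum_add_distrib, Finset.sum_sub_distrib, ← Finset.mul_sum, sum_phase_eq,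
          sum_phase_mul_star, Finset.sum_const, Finset.card_univ, nsmul_eq_mul, Complex.real_smul]
        have hN := inv_card_mul_card (κ := ι → rootsOfUnity 4 ℂ)
        rw [Complex.ofReal_inv, Complex.ofReal_natCast] at hN
        push_cast
        generalize (Fintype.card (ι → rootsOfUnity 4 ℂ) : ℂ) = N at hN
        have hN0 : N ≠ 0 := right_ne_zero_of_mul_eq_one hN
        by_cases h3 : a = b
        · by_cases h4 : c = d
          · simp only [h3, h4, and_self, ne_eq, not_true_eq_false, false_and, if_true, if_false]
            field_simp
            ring
          · simp [h3, h4, Ne.symm h4]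
        · by_cases h4 : a = c ∧ b = d
          · obtain ⟨rfl, rfl⟩ := h4
            simp only [h3, ne_eq, not_false_eq_true, and_self, false_and, if_true, if_false]
            field_simp
            ring
          · simp [h3, h4]
      · rw [if_neg, if_neg]
        · simp [hcd]
        · rintro ⟨-, h, -⟩
          obtain ⟨rfl, rfl⟩ := Prod.mk.inj h
          exact hcd hab
        · rintro ⟨-, rfl, -, h⟩
          exact hcd ⟨h, h⟩
    · rw [if_neg, if_neg]
      · simp [hab]
      · rintro ⟨-, -, h⟩
        exact hab h
      · rintro ⟨h1, -, h, -⟩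
        exact hab ⟨h, by rwa [← h1]⟩
  rw [h]
  obtain ⟨a₀, h₀⟩ := Finset.card_pos.1 (by omega : 0 < t.card)
  refine PointedCone.smul_mem _ (by positivity) (Submodule.sum_mem _ fun z _ => ?_)
  rw [phaseProj_eq_sum h₀]
  exact ketbra_sum_mem_schmidtCone _ (by rw [Finset.card_erase_of_mem h₀, ht]) _ _

variable [Fintype ι] (p : SymplecticPairing ι)

/-- Averaging the corank-one projections also over transversals lowers the Schmidt rank from n to n
- 1, at the price of an identity on the rows (a, b) with a, b from different pairs. -/
theorem smul_opJ_add_restrict_mem {n : ℕ} (hn : Fintype.card ι = 2 * n) (hn1 : 1 ≤ n) :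
    ((n : ℝ) - 1) ^ 2 • (opJ ι + restrict (· = ·) (1 + p.opX))
      + restrict (fun a b => a ≠ b ∧ b ≠ p.partner a) 1 ∈ schmidtCone ι ι (n - 1) := by
  have h : ((n : ℝ) - 1) ^ 2 • (opJ ι + restrict (· = ·) (1 + p.opX))
      + restrict (fun a b => a ≠ b ∧ b ≠ p.partner a) 1
      = (4 * (Fintype.card (ι → ℤˣ) : ℝ)⁻¹) • ∑ e : ι → ℤˣ, Matrix.of (fun x y : ι × ι =>
      (if x.1 = x.2 ∧ y.1 = y.2 ∧ x.1 ∈ p.transversal e ∧ y.1 ∈ p.transversal e then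
        ((n : ℂ) - 1) ^ 2 else 0)
        + (if x.1 ≠ x.2 ∧ x = y ∧ x.1 ∈ p.transversal e ∧ x.2 ∈ p.transversal e then 1 else 0)) := by
    have hN := inv_card_mul_card (κ := ι → ℤˣ)
    rw [Complex.ofReal_inv, Complex.ofReal_natCast] at hN
    ext ⟨a, b⟩ ⟨c, d⟩
    simp only [Matrix.of_apply, Matrix.add_apply, Matrix.smul_apply, Matrix.sum_apply,
      restrict_apply, opJ_apply, opX_apply, one_apply_prod, Complex.real_smul]
    have hne := p.partner_ne a
    have hind : ∀ (e : ι → ℤˣ) (i j : ι),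
        (if i ∈ p.transversal e ∧ j ∈ p.transversal e then (1 : ℂ) else 0)
          = p.ind e i * p.ind e j := by
      intro e i j
      simp only [ind]
      by_cases h1 : i ∈ p.transversal e <;> by_cases h2 : j ∈ p.transversal e <;> simp [h1, h2]
    by_cases hab : a = b
    · subst hab
      by_cases hcd : c = d
      · subst hcd
        have h1 : ∀ e : ι → ℤˣ,
            (if a ∈ p.transversal e ∧ c ∈ p.transversal e then ((n : ℂ) - 1) ^ 2 else 0)
              = ((n : ℂ) - 1) ^ 2 * (p.ind e a * p.ind e c) := by
          intro e
          rw [← hind, mul_ite, mul_one, mul_zero]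
        simp only [true_and, ne_eq, not_true_eq_false, false_and, if_false, add_zero, h1, and_self,
          ← Finset.mul_sum, sum_ind_mul_ind, signC_mul_self, if_true, eq_comm (a := a) (b := c)]
        push_cast
        by_cases h2 : c = a
        · simp only [h2, if_true, if_neg (Ne.symm hne)]
          linear_combination -2 * ((n : ℂ) - 1) ^ 2 * hN
        · by_cases h3 : c = p.partner a
          · simp [h3, hne]
          · simp only [h2, h3, if_false]
            linear_combination -((n : ℂ) - 1) ^ 2 * hN
      · have h3 : ¬(c = p.partner a ∧ d = p.partner a) := fun h => hcd (h.1.trans h.2.symm)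
        have h4 : ¬(a = c ∧ a = d) := fun h => hcd (h.1.symm.trans h.2)
        simp [hcd, h3, h4]
    · by_cases h3 : a = c ∧ b = d
      · obtain ⟨rfl, rfl⟩ := h3
        simp only [hab, ne_eq, not_false_eq_true, true_and, false_and, if_false, zero_add, hind,
          sum_ind_mul_ind, Ne.symm hab, and_self, if_true]
        by_cases h4 : b = p.partner a
        · simp [h4]
        · simp only [h4, if_false, not_false_eq_true, if_true]
          push_cast
          linear_combination -hN
      · simp [hab, h3]
  rw [h]
  exact PointedCone.smul_mem _ (by positivity) (Submodule.sum_mem _ fun e _ =>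
    average_phaseProj_mem (p.card_transversal e hn) hn1)

end SymplecticPairing

/-! ### Sign-block vectors and an operator on the zero line of the witness -/

namespace SymplecticPairing

variable {ι : Type*} [DecidableEq ι] [Fintype ι] (p : SymplecticPairing ι)

/-- The coefficient matrix acting as `[[1, ±1], [±1, 1]]` on every pair except the one represented
by `r`. -/
noncomputable def blockVec (r : ι) (e : ι → ℤˣ) : EuclideanSpace ℂ (ι × ι) :=
  WithLp.toLp 2 fun x => if p.rep x.1 = r then 0 else
    (if x.1 = x.2 then 1 else 0) + (if x.2 = p.partner x.1 then signC (e (p.rep x.1)) else 0)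

omit [DecidableEq ι] in
theorem rep_mem_transversal_one (a : ι) : p.rep a ∈ p.transversal 1 := by
  simp [transversal, sign_rep]

/-- Each block [[1, ε], [ε, 1]] has rank one, being the square of the vector (1, ε), so omitting one
pair leaves rank at most n - 1. -/
theorem blockVec_eq_sum (r : ι) (e : ι → ℤˣ) : p.blockVec r e
    = ∑ a ∈ (p.transversal 1).erase r, tensorVec
      (WithLp.toLp 2 fun x => if x = a then 1 else if x = p.partner a then signC (e a) else 0)
      (WithLp.toLp 2 fun x => if x = a then 1 else if x = p.partner a then signC (e a) else 0) := by
  ext ⟨x, y⟩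
  simp only [blockVec, WithLp.ofLp_sum, Finset.sum_apply, tensorVec_apply]
  have hne := p.partner_ne x
  have h0 : ∀ a ∈ (p.transversal 1).erase r, a ≠ p.rep x →
      (if x = a then (1 : ℂ) else if x = p.partner a then signC (e a) else 0) *
        (if y = a then 1 else if y = p.partner a then signC (e a) else 0) = 0 := by
    intro a ha hax
    have hs : p.sign a = 1 := by
      have := (Finset.mem_filter.1 (Finset.mem_of_mem_erase ha)).2
      simpa using this
    have hr : p.rep a = a := by rw [rep, if_pos hs]
    rw [← hr, ne_eq, rep_eq_rep_iff, not_or] at hax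
    rw [if_neg hax.1, if_neg hax.2, zero_mul]
  by_cases hr : p.rep x = r
  · rw [if_pos hr, Finset.sum_eq_zero]
    intro a ha
    exact h0 a ha (by rw [hr]; exact Finset.ne_of_mem_erase ha)
  · rw [if_neg hr, Finset.sum_eq_single (p.rep x) h0
      (fun h => absurd (Finset.mem_erase.2 ⟨hr, p.rep_mem_transversal_one x⟩) h)]
    have h5 : (-1 : ℤˣ) ≠ 1 := by decide
    rcases Int.units_eq_one_or (p.sign x) with hx | hx
    · have : p.rep x = x := by rw [rep, if_pos hx]
      rw [this]
      by_cases h1 : y = x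
      · subst h1; simp [Ne.symm hne]
      · simp [h1, Ne.symm h1]
    · have : p.rep x = p.partner x := by rw [rep, hx, if_neg h5]
      rw [this]
      simp only [partner_partner, if_neg (Ne.symm hne), if_true]
      by_cases h1 : y = x
      · subst h1; simp [Ne.symm hne]
      · by_cases h2 : y = p.partner x
        · subst h2; simp [Ne.symm hne]
        · simp [h1, Ne.symm h1, h2]

/-- Summed over the omitted pair, two entries survive together n - 1 times if they belong to the
same pair and n - 2 times otherwise. Averaging over signs kills the mixed terms. -/
theorem average_blockVec_mem {n : ℕ} (hn : Fintype.card ι = 2 * n) :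
    Matrix.of (fun x y : ι × ι =>
      (if x.1 = x.2 ∧ y.1 = y.2 then
        ((n : ℂ) - 2) + (if y.1 = x.1 ∨ y.1 = p.partner x.1 then 1 else 0) else 0)
      + (if x.2 = p.partner x.1 ∧ y.2 = p.partner y.1 then
        (if y.1 = x.1 ∨ y.1 = p.partner x.1 then (n : ℂ) - 1 else 0) else 0))
      ∈ schmidtCone ι ι (n - 1) := by
  have h : Matrix.of (fun x y : ι × ι =>
      (if x.1 = x.2 ∧ y.1 = y.2 then
        ((n : ℂ) - 2) + (if y.1 = x.1 ∨ y.1 = p.partner x.1 then 1 else 0) else 0)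
      + (if x.2 = p.partner x.1 ∧ y.2 = p.partner y.1 then
        (if y.1 = x.1 ∨ y.1 = p.partner x.1 then (n : ℂ) - 1 else 0) else 0))
      = ((Fintype.card (ι → ℤˣ) : ℝ)⁻¹) • ∑ r ∈ p.transversal 1, ∑ e : ι → ℤˣ,
        ketbra (p.blockVec r e) := by
    have hN := inv_card_mul_card (κ := ι → ℤˣ)
    rw [Complex.ofReal_inv, Complex.ofReal_natCast] at hN
    ext ⟨a, b⟩ ⟨c, d⟩
    simp only [Matrix.of_apply, Matrix.smul_apply, Matrix.sum_apply, ketbra_apply, blockVec,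
      Complex.real_smul, Complex.ofReal_inv, Complex.ofReal_natCast]
    have h1 : ∀ r, ∑ e : ι → ℤˣ,
        (if p.rep a = r then 0 else (if a = b then 1 else 0) +
          (if b = p.partner a then signC (e (p.rep a)) else 0)) *
        star (if p.rep c = r then 0 else (if c = d then 1 else 0) +
          (if d = p.partner c then signC (e (p.rep c)) else 0))
        = (Fintype.card (ι → ℤˣ) : ℂ) * ((if a = b ∧ c = d then 1 else 0) +
          (if b = p.partner a ∧ d = p.partner c then
            (if c = a ∨ c = p.partner a then 1 else 0) else 0))
          * (1 - (if p.rep a = r then 1 else 0) - (if p.rep c = r then 1 else 0)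
            + (if p.rep a = r then (if p.rep a = p.rep c then 1 else 0) else 0)) := by
      intro r
      by_cases hr : p.rep a = r
      · by_cases hac : p.rep a = p.rep c
        · simp [← hac, hr]
        · have h2 : ¬(r = p.rep c) := fun h => hac (hr.trans h)
          simp [hr, h2, Ne.symm h2]
      · by_cases hc : p.rep c = r
        · simp [hr, hc]
        · simp only [hr, hc, if_false]
          have h2 : ∀ e : ι → ℤˣ,
              ((if a = b then (1 : ℂ) else 0) +
                (if b = p.partner a then signC (e (p.rep a)) else 0)) *
              star ((if c = d then (1 : ℂ) else 0) +
                (if d = p.partner c then signC (e (p.rep c)) else 0))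
              = (if a = b then 1 else 0) * (if c = d then 1 else 0)
                + (if a = b then 1 else 0) * (if d = p.partner c then 1 else 0)
                  * signC (e (p.rep c))
                + (if b = p.partner a then 1 else 0) * (if c = d then 1 else 0)
                  * signC (e (p.rep a))
                + (if b = p.partner a then 1 else 0) * (if d = p.partner c then 1 else 0)
                  * (signC (e (p.rep a)) * signC (e (p.rep c))) := by
            intro e
            rw [star_add, apply_ite star (c = d), apply_ite star (d = p.partner c)]
            simp only [star_one, star_zero, star_signC]
            split_ifs <;> ring
          rw [Finset.sum_congr rfl fun e _ => h2 e]
          simp only [Finset.sum_add_distrib, ← Finset.mul_sum, sum_signC, sum_signC_mul,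
            Finset.sum_const, Finset.card_univ, nsmul_eq_mul, rep_eq_rep_iff, ite_and]
          split_ifs <;> ring
    rw [Finset.sum_congr rfl fun r _ => h1 r, ← Finset.mul_sum]
    simp only [Finset.sum_add_distrib, Finset.sum_sub_distrib, Finset.sum_ite_eq,
      rep_mem_transversal_one, if_true, Finset.sum_const, p.card_transversal 1 hn, nsmul_eq_mul,
      rep_eq_rep_iff, ← mul_assoc, hN]
    split_ifs <;> ring
  rw [h]
  refine PointedCone.smul_mem _ (by positivity) (Submodule.sum_mem _ fun r hr =>
    Submodule.sum_mem _ fun e _ => ?_)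
  rw [blockVec_eq_sum]
  exact ketbra_sum_mem_schmidtCone _
    (by rw [Finset.card_erase_of_mem hr, p.card_transversal 1 hn]) _ _

theorem restrict_partner_one_mem :
    restrict (fun a b => b = p.partner a) 1 ∈ productCone ι ι := by
  have h : restrict (fun a b => b = p.partner a) (1 : Matrix (ι × ι) (ι × ι) ℂ)
      = ∑ a : ι, ketbra (tensorVec (EuclideanSpace.single a (1 : ℂ))
        (EuclideanSpace.single (p.partner a) (1 : ℂ))) := by
    ext ⟨a, b⟩ ⟨c, d⟩
    simp only [restrict_apply, Matrix.sum_apply, ketbra_apply, tensorVec_apply,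
      PiLp.single_apply, one_apply_prod]
    rw [Finset.sum_eq_single a (fun x _ hx => by simp [Ne.symm hx]) (by simp)]
    by_cases h1 : b = p.partner a
    · subst h1
      by_cases h2 : a = c <;> by_cases h3 : p.partner a = d <;>
        simp [h2, h3, eq_comm (a := c), eq_comm (a := d)]
    · simp [h1]
  rw [h]
  exact Submodule.sum_mem _ fun _ _ => ketbra_mem_productCone _ _

/-- Half the sum of the projections onto |a, τa⟩ - |τa, a⟩, with τ the partner map. It cancels the
coherence between (a, τa) and (τa, a) left by the block vectors. -/
theorem antisymmetric_block_mem {k : ℕ} (hk : 2 ≤ k) :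
    Matrix.of (fun x y : ι × ι => if x.2 = p.partner x.1 ∧ y.2 = p.partner y.1 then
      (if y.1 = x.1 then 1 else 0) - (if y.1 = p.partner x.1 then (1 : ℂ) else 0) else 0)
      ∈ schmidtCone ι ι k := by
  let f : ι → EuclideanSpace ℂ (ι × ι) := fun a => ∑ i : Bool,
    tensorVec (EuclideanSpace.single (if i then a else p.partner a) (1 : ℂ))
      (EuclideanSpace.single (if i then p.partner a else a) (if i then 1 else -1))
  have hf : ∀ a x, f a x = if x.2 = p.partner x.1 then
      (if a = x.1 then 1 else 0) - (if a = p.partner x.1 then 1 else 0) else 0 := by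
    intro a x
    have h2 : x.1 = p.partner a ↔ a = p.partner x.1 := by
      rw [eq_comm, partner_eq_iff]
    have h3 := p.partner_ne x.1
    simp only [f, Fintype.sum_bool, PiLp.add_apply, tensorVec_apply, PiLp.single_apply]
    by_cases h4 : a = x.1
    · subst h4
      by_cases h5 : x.2 = p.partner x.1 <;> simp [h5, Ne.symm h3]
    · by_cases h6 : a = p.partner x.1
      · subst h6
        by_cases h5 : x.2 = p.partner x.1 <;> simp [h5, h3, Ne.symm h3]
      · have h7 : ¬x.1 = a := fun h => h4 h.symm
        have h8 : ¬x.1 = p.partner a := fun h => h6 (h2.1 h)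
        simp [h4, h6, h7, h8]
  have h : Matrix.of (fun x y : ι × ι => if x.2 = p.partner x.1 ∧ y.2 = p.partner y.1 then
      (if y.1 = x.1 then 1 else 0) - (if y.1 = p.partner x.1 then (1 : ℂ) else 0) else 0)
      = (2⁻¹ : ℝ) • ∑ a, ketbra (f a) := by
    ext x y
    simp only [Matrix.of_apply, Matrix.smul_apply, Matrix.sum_apply, ketbra_apply, hf]
    have h3 := p.partner_ne x.1
    by_cases h1 : x.2 = p.partner x.1
    · by_cases h2 : y.2 = p.partner y.1
      · have h5 : x.1 = y.1 ↔ y.1 = x.1 := eq_comm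
        have h6 : x.1 = p.partner y.1 ↔ y.1 = p.partner x.1 := by
          rw [eq_comm, partner_eq_iff]
        simp only [h1, h2, and_self, if_true, sub_mul, ite_mul, one_mul, zero_mul,
          Finset.sum_sub_distrib, Finset.sum_ite_eq', Finset.mem_univ, star_sub, apply_ite star,
          star_one, star_zero, partner_eq_iff, h5, h6, Complex.real_smul,
          partner_partner]
        push_cast
        ring
      · simp [h2]
    · simp [h1]
  rw [h]
  exact PointedCone.smul_mem _ (by norm_num) (Submodule.sum_mem _ fun a _ =>
    ketbra_sum_mem_schmidtCone (Finset.univ : Finset Bool) (by simpa using hk) _ _)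

/-- A point outside the PPT region on the boundary of the set of states of Schmidt number
at most `n - 1`. -/
theorem exposed_mem {n : ℕ} (hn : Fintype.card ι = 2 * n) (hn3 : 3 ≤ n) :
    (2 * ((n : ℝ) - 1) ^ 2 + 1) • (1 : Matrix (ι × ι) (ι × ι) ℂ)
      + ((n : ℝ) * (2 * n - 3)) • opJ ι + (2 * ((n : ℝ) - 1) ^ 2 - 1) • p.opX
      ∈ schmidtCone ι ι (n - 1) := by
  have hn' : (3 : ℝ) ≤ n := by exact_mod_cast hn3
  -- The weights match the rows type by type. On rows (a, a), `h1` and `h2` give α+β, β-γ and β at c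
  -- = a, c = τa and otherwise; `h3` and `h5` complete the rows (a, τa) to diagonal entry α+γ =
  -- 4(n-1)²; `h4` adds γ(1 + X) to the identity 2 = α-γ from `h1` on all other rows.
  have h1 := PointedCone.smul_mem _ (by norm_num : (0 : ℝ) ≤ 2)
    (p.smul_opJ_add_restrict_mem hn (by omega))
  have h2 := p.average_blockVec_mem hn
  have h3 := PointedCone.smul_mem _ (by linarith : (0 : ℝ) ≤ (n : ℝ) - 1)
    (p.antisymmetric_block_mem (by omega : 2 ≤ n - 1))
  have h4 := PointedCone.smul_mem _ (by nlinarith : (0 : ℝ) ≤ 2 * ((n : ℝ) - 1) ^ 2 - 1)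
    (p.restrict_one_add_opX_mem (by omega : 2 ≤ n - 1) (fun a b => a ≠ b ∧ b ≠ p.partner a)
      fun a b => by
        rw [ne_eq, partner_inj, partner_partner, ne_eq, eq_comm (a := b),
          eq_comm (a := p.partner a)])
  have h5 := PointedCone.smul_mem _
    (by nlinarith : (0 : ℝ) ≤ 4 * ((n : ℝ) - 1) ^ 2 - 2 * ((n : ℝ) - 1))
    (productCone_le_schmidtCone (by omega : 1 ≤ n - 1) p.restrict_partner_one_mem)
  convert add_mem (add_mem (add_mem (add_mem h1 h2) h3) h4) h5 using 1
  ext ⟨a, b⟩ ⟨c, d⟩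
  have hne := p.partner_ne a
  simp only [Matrix.add_apply, Matrix.smul_apply, Matrix.of_apply, restrict_apply, opJ_apply,
    opX_apply, one_apply_prod, Complex.real_smul]
  push_cast
  by_cases hab : a = b
  · subst hab
    have hne' : ¬(a = p.partner a) := Ne.symm hne
    simp only [hne', true_and, ne_eq, not_true_eq_false, false_and, if_true, if_false,
      signC_mul_self]
    by_cases hcd : c = d
    · subst hcd
      simp only [and_self, if_true, eq_comm (a := a) (b := c)]
      by_cases h6 : c = a
      · subst h6
        simp only [hne', true_or, if_true, if_false]
        ring
      · by_cases h7 : c = p.partner a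
        · subst h7
          simp only [hne, or_true, if_true, if_false]
          ring
        · simp only [h6, h7, or_self, if_false]
          ring
    · have h6 : ¬(c = p.partner a ∧ d = p.partner a) := fun h => hcd (h.1.trans h.2.symm)
      have h7 : ¬(a = c ∧ a = d) := fun h => hcd (h.1.symm.trans h.2)
      simp [hcd, h6, h7]
  · by_cases hb : b = p.partner a
    · subst hb
      have h6 := signC_mul_self (p.sign a)
      simp only [hab, false_and, if_false, not_true_eq_false, and_false, ne_eq, true_and, if_true,
        partner_partner, sign_partner, signC_neg, eq_comm (a := p.partner a) (b := d),
        eq_comm (a := a) (b := c), mul_neg, neg_neg, h6]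
      by_cases h7 : c = a
      · subst h7
        by_cases h8 : d = p.partner c
        · simp [h8, hab]; ring
        · simp [h8]
      · by_cases h8 : c = p.partner a
        · subst h8
          simp [hne]
          split_ifs <;> ring
        · simp [h7, h8]
    · simp [hab, hb]
      split_ifs <;> ring

end SymplecticPairing

namespace SymplecticPairing

/-! ### The witness for the Schmidt number -/

variable {ι : Type*} [Fintype ι] (p : SymplecticPairing ι)

/-- The linear functional `ρ ↦ k (tr ρ - tr (X ρ)) - tr (J ρ)`. -/
noncomputable def witness (k : ℕ) : Matrix (ι × ι) (ι × ι) ℂ →ₗ[ℝ] ℝ where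
  toFun ρ := ((k : ℂ) * (∑ x, ρ x x - ∑ x, p.coef x * ρ (p.dual x) x)
    - ∑ a, ∑ c, ρ (a, a) (c, c)).re
  map_add' ρ σ := by
    rw [← Complex.add_re]
    congr 1
    simp only [Matrix.add_apply, mul_add, Finset.sum_add_distrib]
    ring
  map_smul' c ρ := by
    rw [RingHom.id_apply, smul_eq_mul, ← Complex.re_ofReal_mul]
    congr 1
    have h : ∀ x, p.coef x * ((c : ℂ) * ρ (p.dual x) x) = c * (p.coef x * ρ (p.dual x) x) :=
      fun x => by ring
    simp only [Matrix.smul_apply, Complex.real_smul, h, ← Finset.mul_sum]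
    ring

theorem witness_apply (k : ℕ) (ρ : Matrix (ι × ι) (ι × ι) ℂ) :
    p.witness k ρ = ((k : ℂ) * (∑ x, ρ x x - ∑ x, p.coef x * ρ (p.dual x) x)
      - ∑ a, ∑ c, ρ (a, a) (c, c)).re := rfl

/-- The antisymmetrisation `ξ - X ξ` of a vector. -/
noncomputable def skew (ξ : EuclideanSpace ℂ (ι × ι)) : EuclideanSpace ℂ (ι × ι) :=
  WithLp.toLp 2 fun x => ξ x - p.coef x * ξ (p.dual x)

theorem sum_dual (f : ι × ι → ℂ) : ∑ x, f (p.dual x) = ∑ x, f x :=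
  Equiv.sum_comp ⟨p.dual, p.dual, p.dual_dual, p.dual_dual⟩ f

theorem sum_partner (f : ι → ℂ) : ∑ a, f (p.partner a) = ∑ a, f a :=
  Equiv.sum_comp ⟨p.partner, p.partner, p.partner_partner, p.partner_partner⟩ f

/-- As X is a Hermitian involution, (1 - X)² = 2(1 - X). -/
theorem norm_skew_sq (ξ : EuclideanSpace ℂ (ι × ι)) : ‖p.skew ξ‖ ^ 2
    = 2 * (∑ x, ξ x * star (ξ x) - ∑ x, p.coef x * (ξ (p.dual x) * star (ξ x))).re := by
  have h1 : ((‖p.skew ξ‖ ^ 2 : ℝ) : ℂ)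
      = 2 * (∑ x, ξ x * star (ξ x) - ∑ x, p.coef x * (ξ (p.dual x) * star (ξ x))) := by
    rw [← trace_ketbra]
    have h2 : ∀ x, ketbra (p.skew ξ) x x = ξ x * star (ξ x)
        + ξ (p.dual x) * star (ξ (p.dual x)) - p.coef x * (ξ (p.dual x) * star (ξ x))
        - p.coef (p.dual x) * (ξ (p.dual (p.dual x)) * star (ξ (p.dual x))) := by
      intro x
      have := p.coef_mul_self x
      simp only [ketbra_apply, skew, star_sub, star_mul', star_coef, coef_dual, dual_dual]
      linear_combination ξ (p.dual x) * star (ξ (p.dual x)) * this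
    simp only [Matrix.trace, Matrix.diag, h2, Finset.sum_add_distrib, Finset.sum_sub_distrib]
    rw [p.sum_dual fun x => ξ x * star (ξ x),
      p.sum_dual fun x => p.coef x * (ξ (p.dual x) * star (ξ x))]
    ring
  have h3 := congrArg Complex.re h1
  rw [Complex.ofReal_re] at h3
  rw [h3, ← Complex.re_ofReal_mul]
  norm_num

/-- X sends v ⊗ w to a multiple of Ωw ⊗ Ωv, so 1 - X at most doubles the number of product terms. -/
theorem exists_hasSchmidtRank_skew {ξ : EuclideanSpace ℂ (ι × ι)} {r k : ℕ} (hr : r ≤ k)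
    (h : HasSchmidtRank ξ r) : ∃ l ≤ 2 * k, HasSchmidtRank (p.skew ξ) l := by
  obtain ⟨c, v, w, -, -, -, -, rfl⟩ := h
  have h1 : p.skew (∑ i, (c i : ℂ) • tensorVec (v i) (w i)) = 
      ∑ i ∈ (Finset.univ : Finset (Fin r × Bool)), tensorVec (if i.2 then (c i.1 : ℂ) • v i.1
        else WithLp.toLp 2 fun a => (c i.1 : ℂ) * signC (p.sign a) * w i.1 (p.partner a))
      (if i.2 then w i.1 else WithLp.toLp 2 fun a => signC (p.sign a) * v i.1 (p.partner a)) := by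
    ext x
    simp only [skew, WithLp.ofLp_sum, Finset.sum_apply, tensorVec_apply, PiLp.smul_apply,
      smul_eq_mul]
    simp only [Fintype.sum_prod_type, Fintype.sum_bool, if_true, Finset.mul_sum,
      Finset.sum_add_distrib, sub_eq_add_neg, ← Finset.sum_neg_distrib]
    congr 1
    · exact Finset.sum_congr rfl fun i _ => by simp; ring
    · refine Finset.sum_congr rfl fun i _ => ?_
      simp [coef, dual]
      ring
  rw [h1]
  refine exists_hasSchmidtRank_of_sum _ ?_ _ _
  simp
  omega

/-- With η = ξ - Xξ, the trace bound gives 4|tr ξ|² = |tr η|² ≤ 2k‖η‖², while the witness equals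
k‖η‖²/2 - |tr ξ|². -/
theorem witness_ketbra_nonneg {ξ : EuclideanSpace ℂ (ι × ι)} {k : ℕ}
    (h : ∃ r ≤ k, HasSchmidtRank ξ r) : 0 ≤ p.witness k (ketbra ξ) := by
  obtain ⟨r, hr, h⟩ := h
  obtain ⟨l, hl, hs⟩ := p.exists_hasSchmidtRank_skew hr h
  have h1 := hs.norm_sum_diag_sq_le
  have h2 : ∑ a, p.skew ξ (a, a) = 2 * ∑ a, ξ (a, a) := by
    have h3 : ∀ a, p.skew ξ (a, a) = ξ (a, a) + ξ (p.partner a, p.partner a) := by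
      intro a
      simp [skew, coef, dual]
    simp only [h3, Finset.sum_add_distrib]
    rw [p.sum_partner fun a => ξ (a, a)]
    ring
  have h4 : ∑ a, ∑ c, ketbra ξ (a, a) (c, c) = ((‖∑ a, ξ (a, a)‖ ^ 2 : ℝ) : ℂ) := by
    simp only [ketbra_apply, ← Finset.mul_sum, ← Finset.sum_mul, ← star_sum]
    push_cast
    exact Complex.mul_conj' _
  have h5 : (l : ℝ) ≤ 2 * k := by exact_mod_cast hl
  have h6 : p.witness k (ketbra ξ) = k * (‖p.skew ξ‖ ^ 2 / 2) - ‖∑ a, ξ (a, a)‖ ^ 2 := by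
    rw [witness_apply, h4, norm_skew_sq, Complex.sub_re, Complex.ofReal_re]
    simp only [ketbra_apply]
    rw [← Complex.ofReal_natCast, Complex.re_ofReal_mul]
    ring
  rw [h2, norm_mul, mul_pow] at h1
  have h7 : (l : ℝ) * ‖p.skew ξ‖ ^ 2 ≤ 2 * k * ‖p.skew ξ‖ ^ 2 := by gcongr
  norm_num at h1
  rw [h6]
  linarith

/-- The witness is nonnegative on states of Schmidt number at most `k`. -/
theorem witness_nonneg {k : ℕ} {ρ : Matrix (ι × ι) (ι × ι) ℂ} (h : ρ ∈ schmidtSet ι ι k) :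
    0 ≤ p.witness k ρ := by
  have hc : Convex ℝ {ρ | 0 ≤ p.witness k ρ} := (convex_Ici (0 : ℝ)).linear_preimage (p.witness k)
  refine convexHull_min ?_ hc h
  rintro _ ⟨ξ, -, hξ, rfl⟩
  exact p.witness_ketbra_nonneg hξ

/-- The vector `Ω v`. -/
noncomputable def omega (v : EuclideanSpace ℂ ι) : EuclideanSpace ℂ ι :=
  WithLp.toLp 2 fun b => signC (p.sign b) * v (p.partner b)

/-- X fixes v ⊗ Ωv, and its overlap with ω vanishes because Ω is antisymmetric, so both parts of the
witness are zero. -/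
theorem witness_tensor_omega (k : ℕ) (v : EuclideanSpace ℂ ι) :
    p.witness k (ketbra (tensorVec v (p.omega v))) = 0 := by
  have h1 : ∀ x, p.coef x * tensorVec v (p.omega v) (p.dual x) = tensorVec v (p.omega v) x := by
    intro x
    have := signC_mul_self (p.sign x.1)
    simp only [tensorVec_apply, omega, coef, dual, sign_partner, partner_partner, signC_neg]
    linear_combination v (p.partner x.2) * signC (p.sign x.2) * v x.1 * this
  have h2 : ∑ a, tensorVec v (p.omega v) (a, a) = 0 := by
    have h3 : ∑ a, tensorVec v (p.omega v) (a, a) = -∑ a, tensorVec v (p.omega v) (a, a) := by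
      conv_lhs => rw [← p.sum_partner]
      rw [← Finset.sum_neg_distrib]
      refine Finset.sum_congr rfl fun a _ => ?_
      simp [omega]
      ring
    linear_combination (1 / 2 : ℂ) * h3
  rw [witness_apply]
  simp only [ketbra_apply, ← mul_assoc, h1, sub_self, mul_zero, ← Finset.sum_mul, ← Finset.mul_sum,
    h2, zero_mul, Complex.zero_re]

theorem norm_omega (v : EuclideanSpace ℂ ι) : ‖p.omega v‖ = ‖v‖ := by
  have h : ((‖p.omega v‖ ^ 2 : ℝ) : ℂ) = ((‖v‖ ^ 2 : ℝ) : ℂ) := by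
    rw [← trace_ketbra, ← trace_ketbra]
    simp only [Matrix.trace, Matrix.diag]
    rw [← p.sum_partner fun a => ketbra v a a]
    refine Finset.sum_congr rfl fun a _ => ?_
    have := signC_mul_self (p.sign a)
    simp only [ketbra_apply, omega, star_mul', star_signC]
    linear_combination v (p.partner a) * star (v (p.partner a)) * this
  have h' : ‖p.omega v‖ ^ 2 = ‖v‖ ^ 2 := by exact_mod_cast h
  exact (sq_eq_sq₀ (norm_nonneg _) (norm_nonneg _)).1 h'

variable [DecidableEq ι]

omit [Fintype ι] [DecidableEq ι] in
theorem coef_diag (a : ι) : p.coef (a, a) = -1 := by simp [coef]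

omit [Fintype ι] [DecidableEq ι] in
theorem coef_partner (a : ι) : p.coef (a, p.partner a) = 1 := by simp [coef]

theorem sum_self_dual : ∑ x, (if x = p.dual x then p.coef x else 0) = Fintype.card ι := by
  have h : ∀ a b, ((a, b) = p.dual (a, b)) ↔ b = p.partner a := by
    intro a b
    simp only [dual, Prod.ext_iff, eq_comm (a := a), partner_eq_iff, and_self]
  simp only [Fintype.sum_prod_type, h, Finset.sum_ite_eq', Finset.mem_univ, if_true, coef_partner,
    Finset.sum_const, Finset.card_univ, nsmul_eq_mul, mul_one]

theorem witness_one (k : ℕ) : p.witness k 1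
    = k * ((Fintype.card ι : ℝ) ^ 2 - Fintype.card ι) - Fintype.card ι := by
  have h1 : ∑ x, p.coef x * (1 : Matrix (ι × ι) (ι × ι) ℂ) (p.dual x) x = Fintype.card ι := by
    rw [← p.sum_self_dual]
    refine Finset.sum_congr rfl fun x _ => ?_
    rw [Matrix.one_apply]
    by_cases h : x = p.dual x
    · simp [← h]
    · simp [h, Ne.symm h]
  have h2 : ∑ a : ι, ∑ c : ι, (1 : Matrix (ι × ι) (ι × ι) ℂ) (a, a) (c, c) = Fintype.card ι := by
    simp [one_apply_prod]
  rw [witness_apply, h1, h2]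
  have h3 : ((k : ℂ) * (∑ x, (1 : Matrix (ι × ι) (ι × ι) ℂ) x x - Fintype.card ι)
      - Fintype.card ι)
      = ((k * ((Fintype.card ι : ℝ) ^ 2 - Fintype.card ι) - Fintype.card ι : ℝ) : ℂ) := by
    have h4 : ∑ x : ι × ι, (1 : Matrix (ι × ι) (ι × ι) ℂ) x x = (Fintype.card ι : ℂ) ^ 2 := by
      simp [sq]
    rw [h4]
    push_cast
    ring
  rw [h3, Complex.ofReal_re]

theorem witness_opJ (k : ℕ) : p.witness k (opJ ι)
    = k * (2 * Fintype.card ι) - (Fintype.card ι : ℝ) ^ 2 := by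
  have h0 : ∑ x, opJ ι x x = Fintype.card ι := by
    simp only [opJ_apply, and_self, Fintype.sum_prod_type]
    simp
  have h1 : ∑ x, p.coef x * opJ ι (p.dual x) x = -Fintype.card ι := by
    have : ∀ a b, p.coef (a, b) * opJ ι (p.dual (a, b)) (a, b) = if a = b then -1 else 0 := by
      intro a b
      by_cases h : a = b
      · subst h; simp [opJ_apply, dual, coef_diag]
      · simp [opJ_apply, dual, h]
    simp [Fintype.sum_prod_type, this]
  have h2 : ∑ a : ι, ∑ c : ι, opJ ι (a, a) (c, c) = (Fintype.card ι : ℂ) ^ 2 := by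
    simp [opJ_apply, sq]
  rw [witness_apply, h0, h1, h2]
  have h3 : ((k : ℂ) * ((Fintype.card ι : ℂ) - -Fintype.card ι) - (Fintype.card ι : ℂ) ^ 2)
      = ((k * (2 * Fintype.card ι) - (Fintype.card ι : ℝ) ^ 2 : ℝ) : ℂ) := by
    push_cast; ring
  rw [h3, Complex.ofReal_re]

theorem witness_opX (k : ℕ) : p.witness k p.opX
    = k * (Fintype.card ι - (Fintype.card ι : ℝ) ^ 2) + Fintype.card ι := by
  have h0 : ∑ x, p.opX x x = Fintype.card ι := by
    rw [← p.sum_self_dual]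
    exact Finset.sum_congr rfl fun x _ => p.opX_apply' x x
  have h1 : ∑ x, p.coef x * p.opX (p.dual x) x = (Fintype.card ι : ℂ) ^ 2 := by
    simp [opX_apply', sq]
  have h2 : ∑ a : ι, ∑ c : ι, p.opX (a, a) (c, c) = -Fintype.card ι := by
    simp [opX_apply]
  rw [witness_apply, h0, h1, h2]
  have h3 : ((k : ℂ) * ((Fintype.card ι : ℂ) - (Fintype.card ι : ℂ) ^ 2) - -Fintype.card ι)
      = ((k * (Fintype.card ι - (Fintype.card ι : ℝ) ^ 2) + Fintype.card ι : ℝ) : ℂ) := by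
    push_cast; ring
  rw [h3, Complex.ofReal_re]

/-! ### Membership of symplectically invariant operators in the Schmidt cones -/

/-- The operator `α 1 + β J + γ X`. -/
noncomputable def invariantOp (α β γ : ℝ) : Matrix (ι × ι) (ι × ι) ℂ :=
  α • 1 + β • opJ ι + γ • p.opX

/-- Only α - γ enters, since WX = -W: both 1 - X and J change sign under multiplication by X. -/
theorem witness_invariantOp (k : ℕ) (α β γ : ℝ) : p.witness k (p.invariantOp α β γ)
    = Fintype.card ι * ((k * (Fintype.card ι - 1) - 1) * (α - γ)
      + (2 * k - Fintype.card ι) * β) := by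
  rw [invariantOp, map_add, map_add, map_smul, map_smul, map_smul, witness_one, witness_opJ,
    witness_opX]
  simp only [smul_eq_mul]
  ring

/-- The inequalities satisfied by the parameters of PPT operators imply that the Schmidt number is
at most half of the dimension. -/
theorem invariantOp_mem {n : ℕ} (hn : Fintype.card ι = 2 * n) (hn2 : 2 ≤ n) {α β γ : ℝ}
    (h1 : γ ≤ α) (h2 : β ≤ α) (h3 : γ ≤ α + Fintype.card ι * β)
    (h4 : β ≤ α + Fintype.card ι * γ) : p.invariantOp α β γ ∈ schmidtCone ι ι n := by
  have hA := productCone_le_schmidtCone (by omega : 1 ≤ n) (one_add_opJ_mem (ι := ι))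
  have hB := productCone_le_schmidtCone (by omega : 1 ≤ n) p.one_add_opX_mem
  have hC := p.one_add_opJ_add_opX_mem hn hn2
  have hD := productCone_le_schmidtCone (by omega : 1 ≤ n) p.breuerHall_extreme_mem
  have hd : (0 : ℝ) < Fintype.card ι := by rw [hn]; exact_mod_cast (by omega : 0 < 2 * n)
  set d : ℝ := (Fintype.card ι : ℝ) with hdef
  -- Split the quadrilateral of PPT parameters along its diagonal from 1 + J + X to (d-1)·1 - J - X.
  -- In the first half, α - β vanishes on 1 + J and 1 + J + X and equals d at the remaining vertex,
  -- which gives that vertex its weight.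
  rcases le_total γ β with h | h
  · have h5 : 0 ≤ γ + (α - β) / d := by
      rw [← mul_nonneg_iff_of_pos_left hd]
      have : d * (γ + (α - β) / d) = d * γ + (α - β) := by field_simp
      linarith
    have e : p.invariantOp α β γ = (β - γ) • (1 + opJ ι)
        + (γ + (α - β) / d) • (1 + opJ ι + p.opX)
        + ((α - β) / d) • ((d - 1) • (1 : Matrix (ι × ι) (ι × ι) ℂ) - opJ ι - p.opX) := by
      have h6 : α = (β - γ) + (γ + (α - β) / d) + (α - β) / d * (d - 1) := by field_simp; ring
      rw [invariantOp]
      conv_lhs => rw [h6]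
      module
    rw [e]
    exact add_mem (add_mem (PointedCone.smul_mem _ (by linarith) hA)
      (PointedCone.smul_mem _ h5 hC))
      (PointedCone.smul_mem _ (div_nonneg (by linarith) hd.le) hD)
  · have h5 : 0 ≤ β + (α - γ) / d := by
      rw [← mul_nonneg_iff_of_pos_left hd]
      have : d * (β + (α - γ) / d) = d * β + (α - γ) := by field_simp
      linarith
    have e : p.invariantOp α β γ = (γ - β) • (1 + p.opX)
        + (β + (α - γ) / d) • (1 + opJ ι + p.opX)
        + ((α - γ) / d) • ((d - 1) • (1 : Matrix (ι × ι) (ι × ι) ℂ) - opJ ι - p.opX) := by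
      have h6 : α = (γ - β) + (β + (α - γ) / d) + (α - γ) / d * (d - 1) := by field_simp; ring
      rw [invariantOp]
      conv_lhs => rw [h6]
      module
    rw [e]
    exact add_mem (add_mem (PointedCone.smul_mem _ (by linarith) hB)
      (PointedCone.smul_mem _ h5 hC))
      (PointedCone.smul_mem _ (div_nonneg (by linarith) hd.le) hD)

/-- Within the PPT region, nonnegativity of the witness characterises Schmidt number less than
half of the dimension. -/
theorem invariantOp_mem_of_witness {n : ℕ} (hn : Fintype.card ι = 2 * n) (hn2 : 2 ≤ n)
    {α β γ : ℝ} (h1 : γ ≤ α) (h2 : β ≤ α) (h3 : γ ≤ α + Fintype.card ι * β)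
    (h4 : β ≤ α + Fintype.card ι * γ) (hw : 0 ≤ p.witness (n - 1) (p.invariantOp α β γ)) :
    p.invariantOp α β γ ∈ schmidtCone ι ι (n - 1) := by
  have hA := productCone_le_schmidtCone (by omega : 1 ≤ n - 1) (one_add_opJ_mem (ι := ι))
  have hB := productCone_le_schmidtCone (by omega : 1 ≤ n - 1) p.one_add_opX_mem
  have hD := productCone_le_schmidtCone (by omega : 1 ≤ n - 1) p.breuerHall_extreme_mem
  have hd : (Fintype.card ι : ℝ) = 2 * n := by rw [hn]; push_cast; ring
  have hn2' : (2 : ℝ) ≤ n := by exact_mod_cast hn2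
  rw [witness_invariantOp, hd, Nat.cast_sub (by omega), mul_nonneg_iff_of_pos_left (by linarith)]
    at hw
  rw [hd] at h3 h4 hD
  -- For d = 2n and k = n - 1 the coefficients are k(d-1) - 1 = n(2n-3) and 2k - d = -2.
  have hw' : 2 * β ≤ n * (2 * n - 3) * (α - γ) := by
    push_cast at hw
    linarith
  rcases le_total (β + γ) α with h | h
  -- This is the triangle of the three separable vertices. The functional α - β - γ vanishes on 1 +
  -- J and 1 + X and is 2n + 1 at the third.
  · have hpos : (0 : ℝ) < 2 * n + 1 := by linarith
    have h5 : 0 ≤ β + (α - β - γ) / (2 * n + 1) := by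
      rw [← mul_nonneg_iff_of_pos_left hpos]
      have : (2 * (n : ℝ) + 1) * (β + (α - β - γ) / (2 * n + 1))
          = (2 * n + 1) * β + (α - β - γ) := by field_simp
      linarith
    have h6 : 0 ≤ γ + (α - β - γ) / (2 * n + 1) := by
      rw [← mul_nonneg_iff_of_pos_left hpos]
      have : (2 * (n : ℝ) + 1) * (γ + (α - β - γ) / (2 * n + 1))
          = (2 * n + 1) * γ + (α - β - γ) := by field_simp
      linarith
    have e : p.invariantOp α β γ = (β + (α - β - γ) / (2 * n + 1)) • (1 + opJ ι)
        + (γ + (α - β - γ) / (2 * n + 1)) • (1 + p.opX)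
        + ((α - β - γ) / (2 * n + 1)) •
          ((2 * (n : ℝ) - 1) • (1 : Matrix (ι × ι) (ι × ι) ℂ) - opJ ι - p.opX) := by
      have h7 : α = (β + (α - β - γ) / (2 * n + 1)) + (γ + (α - β - γ) / (2 * n + 1))
          + (α - β - γ) / (2 * n + 1) * (2 * n - 1) := by field_simp; ring
      rw [invariantOp]
      conv_lhs => rw [h7]
      module
    rw [e]
    exact add_mem (add_mem (PointedCone.smul_mem _ h5 hA) (PointedCone.smul_mem _ h6 hB))
      (PointedCone.smul_mem _ (div_nonneg (by linarith) hpos.le) hD)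
  · rcases Nat.lt_or_ge n 3 with h5 | h5
    -- Here the witness inequality reads β + γ ≤ α, so only the segment from 1 + J to 1 + X remains.
    · obtain rfl : n = 2 := by omega
      norm_num at hw'
      have e : p.invariantOp α β γ = β • (1 + opJ ι) + γ • (1 + p.opX) := by
        have h7 : α = β + γ := by linarith
        rw [invariantOp, h7]
        module
      rw [e]
      norm_num at h3 h4
      exact add_mem (PointedCone.smul_mem _ (by linarith) hA)
        (PointedCone.smul_mem _ (by linarith) hB)
    · have hR := p.exposed_mem hn h5
      have hn3 : (3 : ℝ) ≤ n := by exact_mod_cast h5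
      have hpos : 0 < (n : ℝ) * (2 * n - 3) - 2 := by nlinarith
      -- The weight of the operator of `exposed_mem`: β + γ - α vanishes on 1 + J and 1 + X and
      -- takes the value of the denominator there.
      set u := (β + γ - α) / ((n : ℝ) * (2 * n - 3) - 2) with hu
      have hu0 : 0 ≤ u := div_nonneg (by linarith) hpos.le
      have hu1 : u * ((n : ℝ) * (2 * n - 3) - 2) = β + γ - α := div_mul_cancel₀ _ hpos.ne'
      -- Nonnegativity of the weight of 1 + J is precisely the witness inequality.
      have h6 : 0 ≤ α - γ - 2 * u := by
        rw [← mul_nonneg_iff_of_pos_right hpos]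
        linear_combination hw' + 2 * hu1
      -- The bracket equals n - 3.
      have h7 : 0 ≤ (α - β) + u * ((n : ℝ) * (2 * n - 3) - (2 * ((n : ℝ) - 1) ^ 2 + 1)) := by
        have : 0 ≤ u * ((n : ℝ) * (2 * n - 3) - (2 * ((n : ℝ) - 1) ^ 2 + 1)) :=
          mul_nonneg hu0 (by nlinarith)
        linarith
      have e : p.invariantOp α β γ = (α - γ - 2 * u) • (1 + opJ ι)
          + ((α - β) + u * ((n : ℝ) * (2 * n - 3) - (2 * ((n : ℝ) - 1) ^ 2 + 1))) • (1 + p.opX)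
          + u • ((2 * ((n : ℝ) - 1) ^ 2 + 1) • (1 : Matrix (ι × ι) (ι × ι) ℂ)
            + ((n : ℝ) * (2 * n - 3)) • opJ ι + (2 * ((n : ℝ) - 1) ^ 2 - 1) • p.opX) := by
        have e0 : p.invariantOp α β γ = p.invariantOp ((α - γ - 2 * u)
            + ((α - β) + u * ((n : ℝ) * (2 * n - 3) - (2 * ((n : ℝ) - 1) ^ 2 + 1)))
            + u * (2 * ((n : ℝ) - 1) ^ 2 + 1)) ((α - γ - 2 * u) + u * ((n : ℝ) * (2 * n - 3)))
            (((α - β) + u * ((n : ℝ) * (2 * n - 3) - (2 * ((n : ℝ) - 1) ^ 2 + 1)))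
            + u * (2 * ((n : ℝ) - 1) ^ 2 - 1)) := by
          congr 1 <;> linear_combination -hu1
        rw [e0, invariantOp]
        module
      rw [e]
      exact add_mem (add_mem (PointedCone.smul_mem _ h6 hA) (PointedCone.smul_mem _ h7 hB))
        (PointedCone.smul_mem _ hu0 hR)

end SymplecticPairing

theorem partialTranspose_apply {α β : Type*} (ρ : Matrix (α × β) (α × β) ℂ) (x y : α × β) :
    partialTranspose ρ x y = ρ (x.1, y.2) (y.1, x.2) := rfl

/-- A positive semidefinite matrix has nonnegative quadratic form on a family of indices with real
weights. -/
theorem Matrix.PosSemidef.sum_weights_nonneg {σ κ : Type*} [Fintype κ] {A : Matrix σ σ ℂ}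
    (hA : A.PosSemidef) (f : κ → σ) (s : κ → ℝ) :
    0 ≤ (∑ i, ∑ j, (s i : ℂ) * (s j : ℂ) * A (f i) (f j)).re := by
  have h := (hA.submatrix f).dotProduct_mulVec_nonneg fun i => (s i : ℂ)
  have h2 : (star (fun i => (s i : ℂ)) ⬝ᵥ (A.submatrix f f).mulVec fun i => (s i : ℂ))
      = ∑ i, ∑ j, (s i : ℂ) * (s j : ℂ) * A (f i) (f j) := by
    simp only [dotProduct, Matrix.mulVec, Finset.mul_sum, Matrix.submatrix_apply, Pi.star_apply]
    refine Finset.sum_congr rfl fun i _ => Finset.sum_congr rfl fun j _ => ?_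
    simp; ring
  rw [h2] at h
  exact (Complex.le_def.1 h).1

namespace SymplecticPairing

/-! ### Consequences of positivity and of positivity of the partial transpose -/

variable {ι : Type*} [Fintype ι] [DecidableEq ι] (p : SymplecticPairing ι)

omit [Fintype ι] in
theorem invariantOp_apply (α β γ : ℝ) (x y : ι × ι) : p.invariantOp α β γ x y
    = (α : ℂ) * (if x.1 = y.1 ∧ x.2 = y.2 then 1 else 0)
      + (β : ℂ) * (if x.1 = x.2 ∧ y.1 = y.2 then 1 else 0)
      + (γ : ℂ) * (if y.1 = p.partner x.2 ∧ y.2 = p.partner x.1 then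
        -(signC (p.sign x.1) * signC (p.sign x.2)) else 0) := by
  simp only [invariantOp, Matrix.add_apply, Matrix.smul_apply, Complex.real_smul, opJ_apply,
    opX_apply, one_apply_prod]

omit [Fintype ι] in
theorem signC_eq_ofReal (u : ℤˣ) : signC u = (((u : ℤ) : ℝ) : ℂ) := by simp [signC]

-- Test on a -1 eigenvector of X supported on (a, b) and its dual; the conditions on a and b make it
-- orthogonal to the range of J.
omit [Fintype ι] in
theorem le_of_posSemidef {a b : ι} (hab : a ≠ b) (hb : b ≠ p.partner a) {α β γ : ℝ}
    (h : (p.invariantOp α β γ).PosSemidef) : γ ≤ α := by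
  have h1 := h.sum_weights_nonneg
    (fun i : Bool => if i then (a, b) else (p.partner b, p.partner a))
    (fun i => if i then 1 else ((p.sign a : ℤ) : ℝ) * ((p.sign b : ℤ) : ℝ))
  have ha' := signC_mul_self (p.sign a)
  have hb' := signC_mul_self (p.sign b)
  have h2 : ¬(a = p.partner b) := fun h => hb (by rw [h, partner_partner])
  have h3 : (0 : ℝ) ≤ (((2 * α - 2 * γ : ℝ)) : ℂ).re := by
    convert h1 using 2
    simp only [Fintype.sum_bool, if_true, Bool.false_eq_true, if_false, invariantOp_apply,
      partner_partner, hab, hb, h2, and_self, sign_partner, partner_inj, Ne.symm hab,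
      signC_neg, Complex.ofReal_mul, ← signC_eq_ofReal, Ne.symm hb, Ne.symm h2]
    push_cast
    simp only [mul_zero, add_zero, zero_add, mul_one, one_mul]
    linear_combination (2 * (γ : ℂ) - α) * signC (p.sign b) * signC (p.sign b) * ha'
      + (2 * (γ : ℂ) - α) * hb'
  rw [Complex.ofReal_re] at h3
  linarith

/-- Test on Σ|ii⟩, where J has eigenvalue d and X has eigenvalue -1. -/
theorem le_add_of_posSemidef [Nonempty ι] {α β γ : ℝ} (h : (p.invariantOp α β γ).PosSemidef) :
    γ ≤ α + Fintype.card ι * β := by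
  have h1 := h.sum_weights_nonneg (fun i : ι => (i, i)) (fun _ => 1)
  have h3 : (0 : ℝ) ≤ ((Fintype.card ι * (α + Fintype.card ι * β - γ) : ℝ) : ℂ).re := by
    convert h1 using 2
    simp [invariantOp_apply, Finset.sum_add_distrib]
    ring
  rw [Complex.ofReal_re] at h3
  have := nonneg_of_mul_nonneg_right h3 (by exact_mod_cast Fintype.card_pos)
  linarith

-- Partial transposition turns J into the flip, which is -1 on |ab⟩ - |ba⟩; the transpose of X
-- vanishes there.
omit [Fintype ι] in
theorem le_of_posSemidef_partialTranspose {a b : ι} (hab : a ≠ b) (hb : b ≠ p.partner a)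
    {α β γ : ℝ} (h : (partialTranspose (p.invariantOp α β γ)).PosSemidef) : β ≤ α := by
  have h1 := h.sum_weights_nonneg (fun i : Bool => if i then (a, b) else (b, a))
    (fun i => if i then 1 else -1)
  have h2 : ¬(a = p.partner b) := fun h => hb (by rw [h, partner_partner])
  have h3 : (0 : ℝ) ≤ (((2 * α - 2 * β : ℝ)) : ℂ).re := by
    convert h1 using 2
    simp only [Fintype.sum_bool, if_true, Bool.false_eq_true, if_false, partialTranspose_apply,
      invariantOp_apply, hab, hb, h2, false_and, and_self, Ne.symm hab]
    push_cast
    ring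
  rw [Complex.ofReal_re] at h3
  linarith

/-- Test on the antisymmetric vector with coefficient matrix Ω: the flip has eigenvalue -1 and the
partial transpose of X has eigenvalue d. -/
theorem le_add_of_posSemidef_partialTranspose [Nonempty ι] {α β γ : ℝ}
    (h : (partialTranspose (p.invariantOp α β γ)).PosSemidef) :
    β ≤ α + Fintype.card ι * γ := by
  have h1 := h.sum_weights_nonneg (fun i : ι => (i, p.partner i))
    (fun i => ((p.sign i : ℤ) : ℝ))
  have h3 : (0 : ℝ) ≤ ((Fintype.card ι * (α + Fintype.card ι * γ - β) : ℝ) : ℂ).re := by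
    convert h1 using 2
    have h4 : ∀ i j, signC (p.sign i) * signC (p.sign j) *
        partialTranspose (p.invariantOp α β γ) (i, p.partner i) (j, p.partner j)
        = (if i = j then (α : ℂ) else 0) - (if j = p.partner i then (β : ℂ) else 0) + γ := by
      intro i j
      have hi := signC_mul_self (p.sign i)
      have hj := signC_mul_self (p.sign j)
      have hne := p.partner_ne i
      have hij : i = p.partner j ↔ j = p.partner i := by rw [← partner_eq_iff, eq_comm]
      have hij' : p.partner j = p.partner i ↔ i = j := by rw [partner_inj, eq_comm]
      simp only [partialTranspose_apply, invariantOp_apply, partner_partner, hij, hij', and_self,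
        if_true, sign_partner, signC_neg]
      by_cases h5 : i = j
      · subst h5
        simp only [if_true, if_neg (Ne.symm hne)]
        linear_combination ((α : ℂ) + γ * (signC (p.sign i) * signC (p.sign i) + 1)) * hi
      · by_cases h6 : j = p.partner i
        · subst h6
          simp only [h5, if_true, if_false, sign_partner, signC_neg]
          linear_combination (-(β : ℂ) + γ * (signC (p.sign i) * signC (p.sign i) + 1)) * hi
        · simp only [h5, h6, if_false]
          linear_combination (γ : ℂ) * signC (p.sign j) * signC (p.sign j) * hi + (γ : ℂ) * hj
    simp only [← signC_eq_ofReal, h4, Finset.sum_add_distrib, Finset.sum_sub_distrib,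
      Finset.sum_ite_eq, Finset.sum_ite_eq', Finset.mem_univ, if_true, Finset.sum_const,
      Finset.card_univ, nsmul_eq_mul]
    push_cast
    ring
  rw [Complex.ofReal_re] at h3
  have := nonneg_of_mul_nonneg_right h3 (by exact_mod_cast Fintype.card_pos)
  linarith

/-- The partial transpose as a linear map. -/
def partialTransposeMap : Matrix (ι × ι) (ι × ι) ℂ →ₗ[ℝ] Matrix (ι × ι) (ι × ι) ℂ where
  toFun ρ := partialTranspose ρ
  map_add' _ _ := rfl
  map_smul' _ _ := rfl

omit [DecidableEq ι] in
theorem posSemidef_partialTranspose_of_mem {ρ : Matrix (ι × ι) (ι × ι) ℂ}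
    (h : ρ ∈ productCone ι ι) : (partialTranspose ρ).PosSemidef := by
  refine posSemidef_of_mem_schmidtCone (k := 1) (productCone_le_schmidtCone le_rfl ?_)
  refine map_mem_productCone (partialTransposeMap (ι := ι)) (fun v w => ?_) h
  have : partialTransposeMap (ketbra (tensorVec v w)) = ketbra (tensorVec v (conjVec w)) := by
    ext x y
    change partialTranspose _ x y = _
    simp [partialTranspose_apply]
    ring
  rw [this]
  exact ketbra_mem_productCone _ _

/-- 1 + J is separable, and the partial transpose of X is the rank-one operator on the vector with
coefficient matrix Ω. -/
theorem posSemidef_partialTranspose_extreme :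
    (partialTranspose (1 + opJ ι + p.opX)).PosSemidef := by
  have h1 := posSemidef_partialTranspose_of_mem (one_add_opJ_mem (ι := ι))
  have h2 : partialTranspose p.opX = ketbra (WithLp.toLp 2 fun x : ι × ι =>
      if x.2 = p.partner x.1 then signC (p.sign x.1) else 0) := by
    ext ⟨a, b⟩ ⟨c, d⟩
    simp only [partialTranspose_apply, opX_apply, ketbra_apply]
    by_cases hb : b = p.partner a
    · by_cases hd : d = p.partner c
      · subst hb hd; simp
      · have : ¬(c = p.partner d) := fun h => hd (by rw [h, partner_partner])
        simp [hd, this]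
    · simp [hb]
  have h3 : partialTranspose (1 + opJ ι + p.opX)
      = partialTranspose (1 + opJ ι) + partialTranspose p.opX := rfl
  rw [h3, h2]
  exact h1.add (ketbra_posSemidef _)

end SymplecticPairing

/-! ### The standard symplectic form -/

/-- The pairing of `Fin d` underlying the standard symplectic form. -/
def standardPairing (d : ℕ) (hd : Even d) : SymplecticPairing (Fin d) where
  partner i := if h : (i : ℕ) < d / 2 then ⟨i + d / 2, by omega⟩ else ⟨i - d / 2, by omega⟩
  sign i := if (i : ℕ) < d / 2 then 1 else -1
  partner_partner i := by
    obtain ⟨n, rfl⟩ := hd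
    ext
    by_cases h : (i : ℕ) < (n + n) / 2
    · simp [h]
    · have : (i : ℕ) - (n + n) / 2 < (n + n) / 2 := by omega
      simp [h, this]; omega
  sign_partner i := by
    obtain ⟨n, rfl⟩ := hd
    by_cases h : (i : ℕ) < (n + n) / 2
    · simp [h]
    · have : (i : ℕ) - (n + n) / 2 < (n + n) / 2 := by omega
      simp [h, this]

section Standard

variable {d : ℕ} (hd : Even d)

open SymplecticPairing

theorem sympOmega_apply (i j : Fin d) : sympOmega d i j
    = if j = (standardPairing d hd).partner i then signC ((standardPairing d hd).sign i) else 0 := by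
  obtain ⟨n, rfl⟩ := hd
  simp only [sympOmega, Matrix.of_apply, standardPairing, Fin.ext_iff]
  by_cases h : (i : ℕ) < (n + n) / 2
  · have h2 : ¬((i : ℕ) = j + (n + n) / 2) := by omega
    simp [h, h2, signC]
  · have h2 : ¬((j : ℕ) = i + (n + n) / 2) := by omega
    have h3 : ((i : ℕ) = j + (n + n) / 2) ↔ (j : ℕ) = i - (n + n) / 2 := by omega
    simp [h, h2, h3, signC]

theorem ketbra_maxEntangled :
    ketbra (maxEntangled d) = ((d : ℝ)⁻¹) • opJ (Fin d) := by
  have h : ∀ x : Fin d × Fin d, maxEntangled d x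
      = ((1 / Real.sqrt d : ℝ) : ℂ) * if x.1 = x.2 then 1 else 0 := by
    intro x
    simp only [maxEntangled, PiLp.smul_apply, smul_eq_mul, WithLp.ofLp_sum, Finset.sum_apply,
      tensorVec_apply, PiLp.single_apply, ite_mul, one_mul, zero_mul, Finset.sum_ite_eq,
      Finset.mem_univ, if_true]
    by_cases h : x.1 = x.2
    · simp [h]
    · simp [h, Ne.symm h]
  ext x y
  simp only [ketbra_apply, h, Matrix.smul_apply, opJ_apply, Complex.real_smul, star_mul']
  have h2 : ((1 / Real.sqrt d : ℝ) : ℂ) * star ((1 / Real.sqrt d : ℝ) : ℂ) = (((d : ℝ)⁻¹ : ℝ) : ℂ) := by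
    have : star ((1 / Real.sqrt d : ℝ) : ℂ) = ((1 / Real.sqrt d : ℝ) : ℂ) := Complex.conj_ofReal _
    rw [this, ← Complex.ofReal_mul]
    congr 1
    rw [div_mul_div_comm, Real.mul_self_sqrt (Nat.cast_nonneg _)]
    simp
  by_cases h3 : x.1 = x.2 <;> by_cases h4 : y.1 = y.2 <;> simp [h3, h4]
  simpa using h2

theorem conj_flipOp : ((1 : Matrix (Fin d) (Fin d) ℂ) ⊗ₖ sympOmega d) * flipOp d *
    ((1 : Matrix (Fin d) (Fin d) ℂ) ⊗ₖ sympOmega d).conjTranspose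
    = (standardPairing d hd).opX := by
  set p := standardPairing d hd
  ext ⟨a, b⟩ ⟨c, e⟩
  have h1 : ∀ (M : Matrix (Fin d × Fin d) (Fin d × Fin d) ℂ) (x w : Fin d × Fin d),
      (M * flipOp d) x w = M x (w.2, w.1) := by
    intro M x w
    rw [Matrix.mul_apply, Finset.sum_eq_single (w.2, w.1)]
    · simp [flipOp]
    · intro z _ hz
      have : ¬(z.1 = w.2 ∧ z.2 = w.1) := fun h => hz (Prod.ext h.1 h.2)
      simp [flipOp, this]
    · simp
  rw [Matrix.mul_apply, Finset.sum_eq_single (c, a)]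
  · rw [h1]
    simp only [Matrix.kroneckerMap_apply, Matrix.conjTranspose_apply, Matrix.one_apply, if_true,
      one_mul, sympOmega_apply hd, opX_apply]
    change (if c = p.partner b then signC (p.sign b) else 0) *
      star (if a = p.partner e then signC (p.sign e) else 0) = _
    have hae : a = p.partner e ↔ e = p.partner a := by rw [← p.partner_eq_iff, eq_comm]
    simp only [hae]
    by_cases h2 : c = p.partner b <;> by_cases h3 : e = p.partner a
    · subst h2 h3; simp; ring
    · simp [h3]
    · simp [h2]
    · simp [h3]
  · intro w _ hw
    rw [h1]
    simp only [Matrix.kroneckerMap_apply, Matrix.conjTranspose_apply, Matrix.one_apply]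
    by_cases h2 : a = w.2
    · by_cases h3 : c = w.1
      · exact absurd (Prod.ext h3.symm h2.symm) hw
      · simp [h3]
    · simp [h2]
  · simp

theorem sympRho_eq (a b : ℝ) : sympRho d a b
    = (standardPairing d hd).invariantOp ((1 - a - b) / (d : ℝ) ^ 2) (a / d) (b / d) := by
  rw [sympRho, ketbra_maxEntangled, conj_flipOp hd, invariantOp, Complex.coe_smul,
    Complex.coe_smul, Complex.coe_smul, smul_smul, div_eq_mul_inv a]

theorem omegaVec_eq (v : EuclideanSpace ℂ (Fin d)) :
    omegaVec v = (standardPairing d hd).omega v := by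
  ext i
  simp [omegaVec, omega, Matrix.mulVec, dotProduct, sympOmega_apply hd]

end Standard

/-! ### Schmidt number of the mixtures and loss of symplectic symmetry -/

section Main

open SymplecticPairing

variable {d : ℕ}

/-- The parameters of a PPT state satisfy the four inequalities describing the PPT region. -/
theorem inequalities_of_mem_pptRegion (hd : Even d) (hd4 : 4 ≤ d) {a b : ℝ} (h : (a, b) ∈ pptRegion d) :
    b / d ≤ (1 - a - b) / (d : ℝ) ^ 2 ∧ a / d ≤ (1 - a - b) / (d : ℝ) ^ 2 ∧
      b / d ≤ (1 - a - b) / (d : ℝ) ^ 2 + Fintype.card (Fin d) * (a / d) ∧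
      a / d ≤ (1 - a - b) / (d : ℝ) ^ 2 + Fintype.card (Fin d) * (b / d) := by
  obtain ⟨i, j, hij, hj⟩ : ∃ i j : Fin d, i ≠ j ∧ j ≠ (standardPairing d hd).partner i := by
    refine ⟨⟨0, by omega⟩, ⟨1, by omega⟩, by simp, ?_⟩
    have h : 0 < d / 2 := by omega
    simp only [standardPairing, h, dif_pos, ne_eq, Fin.ext_iff]
    omega
  have : Nonempty (Fin d) := ⟨i⟩
  obtain ⟨⟨h1, -⟩, h2⟩ := h
  rw [sympRho_eq hd] at h1 h2
  exact ⟨le_of_posSemidef _ hij hj h1, le_of_posSemidef_partialTranspose _ hij hj h2,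
    le_add_of_posSemidef _ h1, le_add_of_posSemidef_partialTranspose _ h2⟩

theorem sympMixture_eq (hd : Even d) (a b p₀ : ℝ) {m : ℕ} (p : Fin m → ℝ)
    (v : Fin m → EuclideanSpace ℂ (Fin d)) : sympMixture d a b p₀ p v
    = p₀ • sympRho d a b
      + ∑ j, p j • ketbra (tensorVec (v j) ((standardPairing d hd).omega (v j))) := by
  simp only [sympMixture, omegaVec_eq hd, ketbra_kronecker, Complex.coe_smul]

theorem isPPTState_sympMixture (hd : Even d) {a b p₀ : ℝ} {m : ℕ} {p : Fin m → ℝ}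
    {v : Fin m → EuclideanSpace ℂ (Fin d)} (h : IsPPTState (sympRho d a b)) (hv : ∀ j, ‖v j‖ = 1)
    (hp₀ : 0 ≤ p₀) (hp : ∀ j, 0 ≤ p j) (hsum : p₀ + ∑ j, p j = 1) :
    IsPPTState (sympMixture d a b p₀ p v) := by
  obtain ⟨⟨h1, h2⟩, h3⟩ := h
  rw [sympMixture_eq hd]
  refine ⟨⟨?_, ?_⟩, ?_⟩
  · exact (h1.smul hp₀).add (Matrix.posSemidef_sum _ fun j _ => (ketbra_posSemidef _).smul (hp j))
  · simp only [Matrix.trace_add, Matrix.trace_smul, Matrix.trace_sum, h2, trace_ketbra,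
      norm_tensorVec, norm_omega, hv, Complex.real_smul]
    have h4 : ((p₀ + ∑ j, p j : ℝ) : ℂ) = 1 := by rw [hsum, Complex.ofReal_one]
    push_cast at h4
    simpa using h4
  · have h4 := map_add (partialTransposeMap (ι := Fin d)) (p₀ • sympRho d a b)
      (∑ j, p j • ketbra (tensorVec (v j) ((standardPairing d hd).omega (v j))))
    rw [map_sum, map_smul] at h4
    simp only [map_smul] at h4
    change partialTranspose _ = p₀ • partialTranspose _ + ∑ j, p j • partialTranspose _ at h4
    rw [h4]
    exact (h3.smul hp₀).add (Matrix.posSemidef_sum _ fun j _ =>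
      (posSemidef_partialTranspose_of_mem (ketbra_mem_productCone _ _)).smul (hp j))

/-- The product terms have zero witness. A mixture of smaller Schmidt number thus forces a
nonnegative witness at ρ_{a,b}, and exactness of the witness on the PPT region contradicts the
choice of (a, b). -/
theorem hasSchmidtNumber_sympMixture (hd : Even d) (hd4 : 4 ≤ d) {a b p₀ : ℝ} {m : ℕ} {p : Fin m → ℝ}
    {v : Fin m → EuclideanSpace ℂ (Fin d)}
    (h : (a, b) ∈ pptRegion d \ schmidtRegion d (d / 2 - 1)) (hv : ∀ j, ‖v j‖ = 1)
    (hp₀ : 0 < p₀) (hp : ∀ j, 0 ≤ p j) (hsum : p₀ + ∑ j, p j = 1) :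
    HasSchmidtNumber (sympMixture d a b p₀ p v) (d / 2) := by
  have hcard : Fintype.card (Fin d) = 2 * (d / 2) := by
    rw [Fintype.card_fin]
    have := hd.two_dvd
    omega
  obtain ⟨i1, i2, i3, i4⟩ := inequalities_of_mem_pptRegion hd hd4 h.1
  obtain ⟨⟨-, htr⟩, -⟩ := isPPTState_sympMixture hd h.1 hv hp₀.le hp hsum
  constructor
  · refine mem_schmidtSet_of_mem_schmidtCone ?_ htr
    rw [sympMixture_eq hd, sympRho_eq hd]
    exact add_mem (PointedCone.smul_mem _ hp₀.le
      (invariantOp_mem _ hcard (by omega) i1 i2 i3 i4))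
      (Submodule.sum_mem _ fun j _ => PointedCone.smul_mem _ (hp j)
        (ketbra_tensorVec_mem_schmidtCone (by omega) _ _))
  · intro l hl
    by_contra hlt
    have h1 := (standardPairing d hd).witness_nonneg
      (schmidtSet_mono (by omega : l ≤ d / 2 - 1) hl)
    rw [sympMixture_eq hd, map_add, map_sum, map_smul] at h1
    simp only [map_smul, witness_tensor_omega, smul_eq_mul, mul_zero, Finset.sum_const_zero,
      add_zero] at h1
    rw [mul_nonneg_iff_of_pos_left hp₀, sympRho_eq hd] at h1
    refine h.2 (mem_schmidtSet_of_mem_schmidtCone ?_ h.1.1.2)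
    rw [sympRho_eq hd]
    exact invariantOp_mem_of_witness _ hcard (by omega) i1 i2 i3 i4 h1

theorem sympRho_vertex_eq (hd : Even d) (hd4 : 4 ≤ d) : sympRho d (1 / (d + 2)) (1 / (d + 2))
    = (1 / ((d : ℝ) * (d + 2))) • (1 + opJ (Fin d) + (standardPairing d hd).opX) := by
  have hd0 : (d : ℝ) ≠ 0 := by exact_mod_cast (by omega : d ≠ 0)
  have hd2 : (d : ℝ) + 2 ≠ 0 := by positivity
  have h1 : (1 - 1 / ((d : ℝ) + 2) - 1 / (d + 2)) / (d : ℝ) ^ 2 = 1 / (d * (d + 2)) := by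
    field_simp
    ring
  have h2 : 1 / ((d : ℝ) + 2) / d = 1 / (d * (d + 2)) := by field_simp
  rw [sympRho_eq hd, h1, h2, invariantOp, smul_add, smul_add]

/-- At a = b = 1/(d+2) the state is proportional to 1 + J + X, where the witness for k = d/2 - 1 is
d(2k - d) = -2d before normalisation. -/
theorem vertex_mem (hd : Even d) (hd4 : 4 ≤ d) : ((1 / (d + 2), 1 / (d + 2)) : ℝ × ℝ) ∈
    pptRegion d \ schmidtRegion d (d / 2 - 1) := by
  have hcard : Fintype.card (Fin d) = 2 * (d / 2) := by
    rw [Fintype.card_fin]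
    have := hd.two_dvd
    omega
  have hd0 : (4 : ℝ) ≤ d := by exact_mod_cast hd4
  have hκ : 0 < 1 / ((d : ℝ) * (d + 2)) := by positivity
  refine ⟨⟨⟨?_, ?_⟩, ?_⟩, fun h => ?_⟩
  · change (sympRho d (1 / (d + 2)) (1 / (d + 2))).PosSemidef
    rw [sympRho_vertex_eq hd hd4]
    exact (posSemidef_of_mem_schmidtCone
      ((standardPairing d hd).one_add_opJ_add_opX_mem hcard (by omega))).smul hκ.le
  · change (sympRho d (1 / (d + 2)) (1 / (d + 2))).trace = 1
    have h1 : ((1 : Matrix (Fin d × Fin d) (Fin d × Fin d) ℂ) + opJ (Fin d)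
        + (standardPairing d hd).opX).trace = ((d * (d + 2) : ℝ) : ℂ) := by
      have h2 : (opJ (Fin d)).trace = d := by
        simp only [Matrix.trace, Matrix.diag, opJ_apply, and_self, Fintype.sum_prod_type]
        simp
      have h3 : (standardPairing d hd).opX.trace = d := by
        have := (standardPairing d hd).sum_self_dual
        rw [Fintype.card_fin] at this
        rw [← this]
        exact Finset.sum_congr rfl fun x _ => opX_apply' _ x x
      rw [Matrix.trace_add, Matrix.trace_add, h2, h3, Matrix.trace_one]
      simp
      ring
    rw [sympRho_vertex_eq hd hd4, Matrix.trace_smul, h1, Complex.real_smul, ← Complex.ofReal_mul,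
      one_div, inv_mul_cancel₀ (by positivity), Complex.ofReal_one]
  · change (partialTranspose (sympRho d (1 / (d + 2)) (1 / (d + 2)))).PosSemidef
    rw [sympRho_vertex_eq hd hd4]
    exact ((standardPairing d hd).posSemidef_partialTranspose_extreme).smul hκ.le
  · have h1 := (standardPairing d hd).witness_nonneg (h : sympRho d _ _ ∈ _)
    change 0 ≤ (standardPairing d hd).witness (d / 2 - 1)
      (sympRho d (1 / (d + 2)) (1 / (d + 2))) at h1
    rw [sympRho_vertex_eq hd hd4, map_smul, smul_eq_mul, mul_nonneg_iff_of_pos_left hκ, map_add,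
      map_add, witness_one, witness_opJ, witness_opX, Fintype.card_fin] at h1
    have h2 : ((d / 2 - 1 : ℕ) : ℝ) * 2 = d - 2 := by
      have h3 : (d / 2 - 1) * 2 + 2 = d := by
        have := hd.two_dvd
        omega
      have h4 : (((d / 2 - 1) * 2 + 2 : ℕ) : ℝ) = (d : ℝ) := by rw [h3]
      push_cast at h4
      linarith
    nlinarith

theorem sympOmega_mul_transpose (hd : Even d) : sympOmega d * (sympOmega d).transpose = 1 := by
  ext i j
  rw [Matrix.mul_apply, Finset.sum_eq_single ((standardPairing d hd).partner i)]
  · simp only [Matrix.transpose_apply, sympOmega_apply hd, if_true, partner_inj, Matrix.one_apply]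
    by_cases h : i = j
    · subst h; simp
    · simp [h]
  · intro k _ hk
    simp [sympOmega_apply hd, hk]
  · simp

theorem sympOmega_map_star (hd : Even d) : (sympOmega d).map star = sympOmega d := by
  ext i j
  simp only [Matrix.map_apply, sympOmega_apply hd]
  split_ifs <;> simp

theorem sympOmega_mem_compactSymp (hd : Even d) : sympOmega d ∈ compactSymp d := by
  have h1 := sympOmega_mul_transpose hd
  have h2 : star (sympOmega d) = (sympOmega d).transpose := by
    rw [Matrix.star_eq_conjTranspose, Matrix.conjTranspose]
    ext i j
    exact congrFun (congrFun (sympOmega_map_star hd) j) i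
  refine ⟨Matrix.mem_unitaryGroup_iff.2 (by rw [h2, h1]), ?_⟩
  rw [mul_eq_one_comm.1 h1, one_mul]

theorem conj_sympOmega_apply_self (hd : Even d) (ρ : Matrix (Fin d × Fin d) (Fin d × Fin d) ℂ) (i j : Fin d) :
    ((sympOmega d ⊗ₖ sympOmega d) * ρ * (sympOmega d ⊗ₖ sympOmega d).conjTranspose) (i, j) (i, j)
      = ρ ((standardPairing d hd).partner i, (standardPairing d hd).partner j)
        ((standardPairing d hd).partner i, (standardPairing d hd).partner j) := by
  set p := standardPairing d hd with hp
  have h : ∀ z, (sympOmega d ⊗ₖ sympOmega d) (i, j) z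
      = if z = (p.partner i, p.partner j) then signC (p.sign i) * signC (p.sign j) else 0 := by
    intro z
    simp only [Matrix.kroneckerMap_apply, sympOmega_apply hd, ← hp, Prod.ext_iff]
    by_cases h1 : z.1 = p.partner i <;> by_cases h2 : z.2 = p.partner j <;> simp [h1, h2]
  have hi := signC_mul_self (p.sign i)
  have hj := signC_mul_self (p.sign j)
  rw [Matrix.mul_apply]
  simp only [Matrix.conjTranspose_apply, Matrix.mul_apply, h, ite_mul, zero_mul,
    Finset.sum_ite_eq', Finset.mem_univ, if_true, apply_ite star, star_zero, mul_ite, mul_zero,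
    star_mul', star_signC]
  set r := ρ (p.partner i, p.partner j) (p.partner i, p.partner j)
  linear_combination r * signC (p.sign j) * signC (p.sign j) * hi + r * hj

/-- A nontrivial mixture with one product vector is not invariant under the symplectic form. -/
theorem conj_sympOmega_sympMixture_ne (hd : Even d) (a b p₀ : ℝ) {p : Fin 1 → ℝ} (hp : p 0 ≠ 0) (i : Fin d) :
    (sympOmega d ⊗ₖ sympOmega d) *
      sympMixture d a b p₀ p (fun _ => EuclideanSpace.single i 1) *
      (sympOmega d ⊗ₖ sympOmega d).conjTranspose
      ≠ sympMixture d a b p₀ p (fun _ => EuclideanSpace.single i 1) := by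
  intro h
  -- Conjugation by Ω ⊗ Ω exchanges the diagonal entries at (i, τi) and (τi, i). These agree for
  -- ρ_{a,b}, but e_i ⊗ Ωe_i is supported on (i, τi) alone.
  have h1 := congrFun (congrFun h (i, (standardPairing d hd).partner i))
    (i, (standardPairing d hd).partner i)
  rw [conj_sympOmega_apply_self hd, sympMixture_eq hd, sympRho_eq hd] at h1
  have hne := (standardPairing d hd).partner_ne i
  have hs := signC_mul_self ((standardPairing d hd).sign i)
  simp only [Matrix.add_apply, Matrix.smul_apply, invariantOp_apply,
    partner_partner, ketbra_apply, tensorVec_apply, omega, PiLp.single_apply, hne, Ne.symm hne,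
    Fin.sum_univ_one, sign_partner, signC_neg, and_self, if_true, if_false, mul_zero,
    star_zero, smul_zero, one_mul, mul_one, star_neg, star_signC, mul_neg, neg_mul, neg_neg, hs,
    add_zero] at h1
  simp [hp] at h1

end Main

theorem mainTheorem12 (d : ℕ) (hd : Even d) (hd4 : 4 ≤ d) :
    (∀ a b : ℝ, (a, b) ∈ pptRegion d \ schmidtRegion d (d / 2 - 1) →
      ∀ (m : ℕ) (v : Fin m → EuclideanSpace ℂ (Fin d)) (p₀ : ℝ) (p : Fin m → ℝ),
        (∀ j, ‖v j‖ = 1) → 0 < p₀ → (∀ j, 0 ≤ p j) → p₀ + ∑ j, p j = 1 →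
          IsPPTState (sympMixture d a b p₀ p v) ∧
            HasSchmidtNumber (sympMixture d a b p₀ p v) (d / 2)) ∧
    (∃ a b : ℝ, (a, b) ∈ pptRegion d \ schmidtRegion d (d / 2 - 1) ∧
      ∃ (m : ℕ) (v : Fin m → EuclideanSpace ℂ (Fin d)) (p₀ : ℝ) (p : Fin m → ℝ),
        (∀ j, ‖v j‖ = 1) ∧ 0 < p₀ ∧ (∀ j, 0 ≤ p j) ∧ p₀ + ∑ j, p j = 1 ∧
          ¬ IsSSbarInvariant (sympMixture d a b p₀ p v) ∧
          ¬ IsSSInvariant (sympMixture d a b p₀ p v)) := by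
  refine ⟨fun a b h m v p₀ p hv hp₀ hp hsum =>
    ⟨isPPTState_sympMixture hd h.1 hv hp₀.le hp hsum,
      hasSchmidtNumber_sympMixture hd hd4 h hv hp₀ hp hsum⟩,
    1 / (d + 2), 1 / (d + 2), vertex_mem hd hd4, 1,
    fun _ => EuclideanSpace.single ⟨0, by omega⟩ 1, 1 / 2, fun _ => 1 / 2, fun j => by simp,
    by norm_num, fun j => by norm_num, by norm_num, fun h => ?_, fun h => ?_⟩
  · have h1 := h _ (sympOmega_mem_compactSymp hd)
    -- Ω is real, so S ⊗ S̄ and S ⊗ S coincide at S = Ω and one computation refutes both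
    -- invariances.
    rw [sympOmega_map_star hd] at h1
    exact conj_sympOmega_sympMixture_ne hd _ _ _ (by norm_num) _ h1
  · exact conj_sympOmega_sympMixture_ne hd _ _ _ (by norm_num) _
      (h _ (sympOmega_mem_compactSymp hd))
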